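/- Let $(M,\langle\cdot,\cdot\rangle,\varphi,\zeta)$ be a $(2n+1)$-dimensional almost contact metric manifold: $(M,\langle\cdot,\cdot\rangle)$ is a smooth Riemannian manifold, $\varphi$ is a smooth $(1,1)$-tensor field and $\zeta$ is a smooth unit vector field such that, with $\eta=\zeta^\flat$, $\varphi^2=-I+\eta\otimes\zeta$ and $\langle\varphi X,\varphi Y\rangle=\langle X,Y\rangle-\eta(X)\eta(Y)$. **Notation.** $F=\langle\cdot,\varphi\,\cdot\rangle$ is the fundamental two-form, $\nabla$ is the Levi-Civita connection, $X_{\zeta^\perp}=X-\eta(X)\zeta$, $\{e_i\}$ is an orthonormal basis of the tangent space at the point considered, repeated indices are summed, and $\alpha\wedge\beta=\alpha\otimes\beta-\beta\otimes\alpha$ for one-forms. For a tensor field $\Psi$, $\nabla^*\nabla\Psi=-(\nabla^2\Psi)_{e_i,e_i}$, where $(\nabla^2\Psi)_{X,Y}=\nabla_X(\nabla_Y\Psi)-\nabla_{\nabla_XY}\Psi$. At each point, $\mathfrak u(n)$ is the space of two-forms $b\in\Lambda^2\eta^\perp$ with $b(\varphi X,\varphi Y)=b(X_{\zeta^\perp},Y_{\zeta^\perp})$,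 and a skew-symmetric endomorphism $A$ belongs to $\mathfrak u(n)$ if $\langle\cdot,A\,\cdot\rangle$ does; $\mathfrak u(n)^\perp$ is the orthogonal complement of $\mathfrak u(n)$ in the skew-symmetric endomorphisms, and $\zeta^\perp_c=\{a\otimes\zeta-\eta\otimes a^\sharp : a\in\eta^\perp\}$. The $U(n)$-intrinsic torsion $$\xi_X=-\tfrac12\,\varphi\circ\nabla_X\varphi+\nabla_X\eta\otimes\zeta-\tfrac12\,\eta\otimes\nabla_X\zeta$$ is the unique tensor with $\xi_X\in\mathfrak u(n)^\perp$ for which $\nabla^{U(n)}=\nabla+\xi$ satisfies $\nabla^{U(n)}\varphi=0$ and $\nabla^{U(n)}\zeta=0$. An endomorphism $A$ acts on a one-form $\theta$ by $(A\theta)(X)=-\theta(AX)$. The structure is *harmonic* if $d^*\xi=-(\nabla_{e_i}\xi)_{e_i}$ vanishes identically. **Theorem.** The following conditions (each required at every point of $M$ and for all tangent vectors $X,Y$) are equivalent: 1. $(M,\langle\cdot,\cdot\rangle,\varphi,\zeta)$ is harmonic. 2. $\nabla^*\nabla\varphi\in\mathfrak u(n)+\zeta^\perp_c$ and $\nabla^*\nabla\zeta=-\xi_{e_i}\xi_{e_i}\zeta$.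 3. $[\nabla^*\nabla\varphi,\varphi]=3\,\eta\otimes\nabla^*\nabla\zeta-3\,\nabla^*\nabla\eta\otimes\zeta$ and $\nabla^*\nabla\zeta=-\xi_{e_i}\xi_{e_i}\zeta$. 4. $\nabla^*\nabla F\in\mathfrak u(n)+\eta^\perp\wedge\eta$ (equivalently, $\nabla^*\nabla F(\varphi X,\varphi Y)=\nabla^*\nabla F(X_{\zeta^\perp},Y_{\zeta^\perp})$), and $\nabla^*\nabla\eta=-\xi_{e_i}(\xi_{e_i}\eta)$. 5. $\nabla^*\nabla F(\varphi X,\varphi Y)=\nabla^*\nabla F(X,Y)-3\,\eta\wedge\big((\nabla^*\nabla\eta)\circ\varphi\big)(X,Y)$ and $\nabla^*\nabla\eta=-\xi_{e_i}(\xi_{e_i}\eta)$. 6. $\nabla^*\nabla F(X,Y)=-4F(\xi_{e_i}X,\xi_{e_i}Y)+(\xi_{e_i}\eta)\wedge\big((\xi_{e_i}\eta)\circ\varphi\big)(X,Y)+\eta\wedge\big((\xi_{e_i}(\xi_{e_i}\eta))\circ\varphi\big)(X,Y)$. 7. $\langle(\nabla^{U(n)}_{e_i}\xi)_{e_i}X_{\zeta^\perp},Y_{\zeta^\perp}\rangle+\langle\xi_{\xi_{e_i}e_i}X_{\zeta^\perp},Y_{\zeta^\perp}\rangle=0$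 and $(\nabla^{U(n)}_{e_i}\xi)_{e_i}\eta+\xi_{\xi_{e_i}e_i}\eta=0$. In particular, if the structure is of type $\mathcal C_5\oplus\dots\oplus\mathcal C_{10}\oplus\mathcal C_{12}$, that is, if $\xi$ is a section of $T^*M\otimes(\eta^\perp\wedge\eta)$ (equivalently, $\xi_X\in\zeta^\perp_c$ for all $X$), then it is harmonic if and only if $\nabla^*\nabla\zeta=\|\nabla\zeta\|^2\zeta$, that is, $\zeta$ is a harmonic unit vector field. -/

import Mathlib

open Bundle FiberBundle Module
open scoped Manifold ContDiff Topology

set_option linter.unusedSectionVars false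

noncomputable section

section
variable {E : Type*} [NormedAddCommGroup E] [NormedSpace ℝ E]  [FiniteDimensional ℝ E]
  {M : Type*} [TopologicalSpace M] [ChartedSpace E M] [IsManifold 𝓘(ℝ, E) ∞ M]
  [RiemannianBundle (fun x : M ↦ TangentSpace 𝓘(ℝ, E) x)]
  [IsContMDiffRiemannianBundle 𝓘(ℝ, E) ∞ E (fun x : M ↦ TangentSpace 𝓘(ℝ, E) x)]

instance tangentSpace_finiteDimensional (x : M) : FiniteDimensional ℝ (TangentSpace 𝓘(ℝ, E) x) :=
  inferInstanceAs (FiniteDimensional ℝ E)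

instance tangentSpace_completeSpace (x : M) : CompleteSpace (TangentSpace 𝓘(ℝ, E) x) :=
  FiniteDimensional.complete ℝ _

variable {X Y Z : Π x : M, TangentSpace 𝓘(ℝ, E) x} {x : M}

theorem mdifferentiableAt_inner (hX : MDiffAt (T% X) x) (hY : MDiffAt (T% Y) x) :
    MDiffAt (fun y ↦ inner ℝ (X y) (Y y)) x :=
  MDifferentiableAt.inner_bundle (E := fun x : M ↦ TangentSpace 𝓘(ℝ, E) x) (F := E) hX hY

/-- The right-hand side of the Koszul formula for `⟪∇_X Y, Z⟫`. -/
def koszul (Y X Z : Π x : M, TangentSpace 𝓘(ℝ, E) x) (x : M) : ℝ :=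
  (1 / 2) * (d% (fun y ↦ inner ℝ (Y y) (Z y)) x (X x)
    + d% (fun y ↦ inner ℝ (Z y) (X y)) x (Y x)
    - d% (fun y ↦ inner ℝ (X y) (Y y)) x (Z x)
    + inner ℝ (VectorField.mlieBracket 𝓘(ℝ, E) X Y x) (Z x)
    - inner ℝ (VectorField.mlieBracket 𝓘(ℝ, E) Y Z x) (X x)
    + inner ℝ (VectorField.mlieBracket 𝓘(ℝ, E) Z X x) (Y x))

theorem dinner_smul_left {f : M → ℝ} (hf : MDiffAt f x) (hX : MDiffAt (T% X) x)
    (hY : MDiffAt (T% Y) x) (v : TangentSpace 𝓘(ℝ, E) x) :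
    d% (fun y ↦ inner ℝ ((f • X) y) (Y y)) x v =
      f x * d% (fun y ↦ inner ℝ (X y) (Y y)) x v + inner ℝ (X x) (Y x) * d% f x v := by
  have e := mvfderiv_fun_mul hf (mdifferentiableAt_inner hX hY)
  have : (fun y ↦ inner ℝ ((f • X) y) (Y y)) = fun y ↦ f y * inner ℝ (X y) (Y y) := by
    funext y; simp [inner_smul_left]
  rw [this, e]; simp

theorem dinner_add_left {X' : Π x : M, TangentSpace 𝓘(ℝ, E) x} (hX : MDiffAt (T% X) x)
    (hX' : MDiffAt (T% X') x) (hY : MDiffAt (T% Y) x) (v : TangentSpace 𝓘(ℝ, E) x) :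
    d% (fun y ↦ inner ℝ ((X + X') y) (Y y)) x v =
      d% (fun y ↦ inner ℝ (X y) (Y y)) x v + d% (fun y ↦ inner ℝ (X' y) (Y y)) x v := by
  have e := mvfderiv_fun_add (mdifferentiableAt_inner hX hY) (mdifferentiableAt_inner hX' hY)
  have : (fun y ↦ inner ℝ ((X + X') y) (Y y)) =
      fun y ↦ inner ℝ (X y) (Y y) + inner ℝ (X' y) (Y y) := by
    funext y; simp [inner_add_left]
  rw [this, e]; simp

theorem dinner_comm (v : TangentSpace 𝓘(ℝ, E) x) :
    d% (fun y ↦ inner ℝ (X y) (Y y)) x v = d% (fun y ↦ inner ℝ (Y y) (X y)) x v := by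
  simp only [real_inner_comm]

theorem koszul_tensorial₁ (hY : MDiffAt (T% Y) x) (hZ : MDiffAt (T% Z) x) :
    TensorialAt 𝓘(ℝ, E) E (fun X ↦ koszul Y X Z x) x where
  smul {f X} hf hX := by
    simp only [koszul]
    rw [dinner_comm (X := Z), dinner_smul_left hf hX hZ, dinner_smul_left hf hX hY,
      dinner_comm (X := Z),
      VectorField.mlieBracket_smul_left hf hX, VectorField.mlieBracket_smul_right hf hX]
    simp [inner_smul_left, inner_smul_right, inner_add_left, real_inner_comm]
    rw [real_inner_comm (X x) (Z x)]
    ring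
  add {X X'} hX hX' := by
    simp only [koszul]
    rw [dinner_comm (X := Z), dinner_add_left hX hX' hZ, dinner_add_left hX hX' hY,
      dinner_comm (X := Z), dinner_comm (X := Z),
      VectorField.mlieBracket_add_left hX hX', VectorField.mlieBracket_add_right hX hX']
    simp [inner_add_left, inner_add_right]
    ring

theorem koszul_tensorial₂ (hY : MDiffAt (T% Y) x) (hX : MDiffAt (T% X) x) :
    TensorialAt 𝓘(ℝ, E) E (fun Z ↦ koszul Y X Z x) x where
  smul {f Z} hf hZ := by
    simp only [koszul]
    rw [dinner_comm (X := Y), dinner_smul_left hf hZ hX, dinner_smul_left hf hZ hY,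
      dinner_comm (Y := Y),
      VectorField.mlieBracket_smul_left hf hZ, VectorField.mlieBracket_smul_right hf hZ]
    simp [inner_smul_left, inner_smul_right, inner_add_left, real_inner_comm]
    ring
  add {Z Z'} hZ hZ' := by
    simp only [koszul]
    rw [dinner_comm (X := Y), dinner_add_left hZ hZ' hX, dinner_add_left hZ hZ' hY,
      dinner_comm (Y := Y), dinner_comm (Y := Y),
      VectorField.mlieBracket_add_left hZ hZ', VectorField.mlieBracket_add_right hZ hZ']
    simp [inner_add_left, inner_add_right]
    ring

theorem koszul_add {Y' : Π x : M, TangentSpace 𝓘(ℝ, E) x} (hY : MDiffAt (T% Y) x)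
    (hY' : MDiffAt (T% Y') x) (hX : MDiffAt (T% X) x) (hZ : MDiffAt (T% Z) x) :
    koszul (Y + Y') X Z x = koszul Y X Z x + koszul Y' X Z x := by
  simp only [koszul]
  rw [dinner_comm (X := X), dinner_add_left hY hY' hX, dinner_add_left hY hY' hZ,
    dinner_comm (X := Y) (Y := X), dinner_comm (X := Y') (Y := X),
    VectorField.mlieBracket_add_left hY hY', VectorField.mlieBracket_add_right hY hY']
  simp [inner_add_left, inner_add_right]
  ring

theorem koszul_leibniz {f : M → ℝ} (hf : MDiffAt f x) (hY : MDiffAt (T% Y) x)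
    (hX : MDiffAt (T% X) x) (hZ : MDiffAt (T% Z) x) :
    koszul (f • Y) X Z x = f x * koszul Y X Z x + d% f x (X x) * inner ℝ (Y x) (Z x) := by
  simp only [koszul]
  rw [dinner_comm (X := X), dinner_smul_left hf hY hX, dinner_smul_left hf hY hZ,
    dinner_comm (X := Y) (Y := X),
    VectorField.mlieBracket_smul_left hf hY, VectorField.mlieBracket_smul_right hf hY]
  simp [inner_smul_left, inner_smul_right, inner_add_left, real_inner_comm]
  ring

open Classical in
/-- `(X, Z) ↦ ⟪∇_X Y, Z⟫` at `x`, as a bilinear form on the tangent space. -/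
def koszulForm (Y : Π x : M, TangentSpace 𝓘(ℝ, E) x) (x : M) :
    TangentSpace 𝓘(ℝ, E) x →L[ℝ] TangentSpace 𝓘(ℝ, E) x →L[ℝ] ℝ :=
  if hY : MDiffAt (T% Y) x then
    TensorialAt.mkHom₂ (koszul Y · · x) x (fun _ hZ ↦ koszul_tensorial₁ hY hZ)
      (fun _ hX ↦ koszul_tensorial₂ hY hX)
  else 0

theorem koszulForm_apply (hY : MDiffAt (T% Y) x) (hX : MDiffAt (T% X) x)
    (hZ : MDiffAt (T% Z) x) : koszulForm Y x (X x) (Z x) = koszul Y X Z x := by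
  rw [koszulForm, dif_pos hY]
  exact TensorialAt.mkHom₂_apply _ _ hX hZ

theorem koszulForm_apply_extend (hY : MDiffAt (T% Y) x) (v w : TangentSpace 𝓘(ℝ, E) x) :
    koszulForm Y x v w = koszul Y (extend E v) (extend E w) x := by
  have h := koszulForm_apply hY (mdifferentiableAt_extend 𝓘(ℝ, E) E v)
    (mdifferentiableAt_extend 𝓘(ℝ, E) E w)
  simpa using h

/-- The vector `∇_v Y`, obtained from `koszulForm` by the Riesz representation. -/
def leviCivitaFun (Y : Π x : M, TangentSpace 𝓘(ℝ, E) x) (x : M) :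
    TangentSpace 𝓘(ℝ, E) x →L[ℝ] TangentSpace 𝓘(ℝ, E) x :=
  LinearMap.toContinuousLinearMap
    { toFun := fun v ↦ (InnerProductSpace.toDual ℝ (TangentSpace 𝓘(ℝ, E) x)).symm
        (koszulForm Y x v)
      map_add' := fun v w ↦ by rw [map_add, map_add]
      map_smul' := fun c v ↦ by rw [map_smul, map_smulₛₗ]; rfl }

theorem inner_leviCivitaFun (Y : Π x : M, TangentSpace 𝓘(ℝ, E) x) (x : M)
    (v w : TangentSpace 𝓘(ℝ, E) x) : inner ℝ (leviCivitaFun Y x v) w = koszulForm Y x v w :=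
  InnerProductSpace.toDual_symm_apply

/-- The Levi-Civita connection of the Riemannian metric (defined by the Koszul formula; it is metric
and torsion-free by `leviCivita_metric` and `leviCivita_torsion`).
`leviCivita Y x v` is `∇_v Y` at `x`. -/
def leviCivita : CovariantDerivative 𝓘(ℝ, E) E (TangentSpace 𝓘(ℝ, E) : M → Type _) where
  toFun := leviCivitaFun
  isCovariantDerivativeOnUniv :=
    { add := fun {Y Y' x} hY hY' _ ↦ by
        ext v
        refine ext_inner_right ℝ fun w ↦ ?_
        have hYY : MDiffAt (T% (Y + Y')) x := mdifferentiableAt_add_section hY hY'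
        rw [inner_leviCivitaFun, add_apply, inner_add_left, inner_leviCivitaFun, inner_leviCivitaFun,
          koszulForm_apply_extend hYY, koszulForm_apply_extend hY, koszulForm_apply_extend hY',
          koszul_add hY hY' (mdifferentiableAt_extend 𝓘(ℝ, E) E v)
            (mdifferentiableAt_extend 𝓘(ℝ, E) E w)]
      leibniz := fun {Y f x} hY hf _ ↦ by
        ext v
        refine ext_inner_right ℝ fun w ↦ ?_
        have hfY : MDiffAt (T% (f • Y)) x := hf.smul_section hY
        rw [inner_leviCivitaFun, add_apply, inner_add_left,
          smul_apply, inner_smul_left, inner_leviCivitaFun,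
          koszulForm_apply_extend hfY, koszulForm_apply_extend hY,
          koszul_leibniz hf hY (mdifferentiableAt_extend 𝓘(ℝ, E) E v)
            (mdifferentiableAt_extend 𝓘(ℝ, E) E w)]
        simp [inner_smul_left] }

theorem leviCivita_koszul (hY : MDiffAt (T% Y) x) (hX : MDiffAt (T% X) x)
    (hZ : MDiffAt (T% Z) x) : inner ℝ (leviCivita Y x (X x)) (Z x) = koszul Y X Z x := by
  rw [← koszulForm_apply hY hX hZ]; exact inner_leviCivitaFun Y x _ _

theorem leviCivita_metric (hY : MDiffAt (T% Y) x) (hZ : MDiffAt (T% Z) x)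
    (v : TangentSpace 𝓘(ℝ, E) x) :
    d% (fun y ↦ inner ℝ (Y y) (Z y)) x v =
      inner ℝ (leviCivita Y x v) (Z x) + inner ℝ (Y x) (leviCivita Z x v) := by
  have hv := mdifferentiableAt_extend 𝓘(ℝ, E) E v
  have h1 := leviCivita_koszul hY hv hZ
  have h2 := leviCivita_koszul hZ hv hY
  rw [extend_apply_self] at h1 h2
  rw [real_inner_comm _ (Y x), h1, h2]
  simp only [koszul, extend_apply_self]
  rw [dinner_comm (X := Z) (Y := Y), dinner_comm (X := Z) (Y := extend E v),
    dinner_comm (X := Y) (Y := extend E v),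
    VectorField.mlieBracket_swap_apply (V := Z) (W := Y),
    VectorField.mlieBracket_swap_apply (V := Z) (W := extend E v),
    VectorField.mlieBracket_swap_apply (V := Y) (W := extend E v)]
  simp only [inner_neg_left]
  ring

theorem leviCivita_torsion (hX : MDiffAt (T% X) x) (hY : MDiffAt (T% Y) x) :
    leviCivita Y x (X x) - leviCivita X x (Y x) = VectorField.mlieBracket 𝓘(ℝ, E) X Y x := by
  refine ext_inner_right ℝ fun w ↦ ?_
  have hw := mdifferentiableAt_extend 𝓘(ℝ, E) E w
  have h1 := leviCivita_koszul hY hX hw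
  have h2 := leviCivita_koszul hX hY hw
  rw [extend_apply_self] at h1 h2
  rw [inner_sub_left, h1, h2]
  simp only [koszul, extend_apply_self]
  rw [dinner_comm (X := extend E w) (Y := Y), dinner_comm (X := extend E w) (Y := X),
    dinner_comm (X := Y) (Y := X),
    VectorField.mlieBracket_swap_apply (V := Y) (W := X),
    VectorField.mlieBracket_swap_apply (V := extend E w) (W := X),
    VectorField.mlieBracket_swap_apply (V := extend E w) (W := Y)]
  simp only [inner_neg_left]
  ring

/-! ### Covariant derivatives of tensor fields

Tensor fields are families of maps on the tangent spaces, and `D Y x v` is `D_v Y` at `x` for a linear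
connection `D` on the tangent bundle. The vectors to which a tensor is applied are extended to
locally smooth vector fields; for a smooth tensor field, the values do not depend on the extensions. -/

/-- The covariant derivative `(D_v A) w` of a `(1,1)`-tensor field. -/
def covEnd (D : (Π x : M, TangentSpace 𝓘(ℝ, E) x) →
      Π x : M, TangentSpace 𝓘(ℝ, E) x → TangentSpace 𝓘(ℝ, E) x)
    (A : Π x : M, TangentSpace 𝓘(ℝ, E) x → TangentSpace 𝓘(ℝ, E) x)
    (x : M) (v w : TangentSpace 𝓘(ℝ, E) x) : TangentSpace 𝓘(ℝ, E) x :=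
  D (fun y ↦ A y (extend E w y)) x v - A x (D (extend E w) x v)

/-- The covariant derivative `(D_v B)(u, w)` of a `(1,2)`-tensor field. -/
def covEnd₂ (D : (Π x : M, TangentSpace 𝓘(ℝ, E) x) →
      Π x : M, TangentSpace 𝓘(ℝ, E) x → TangentSpace 𝓘(ℝ, E) x)
    (B : Π x : M, TangentSpace 𝓘(ℝ, E) x → TangentSpace 𝓘(ℝ, E) x → TangentSpace 𝓘(ℝ, E) x)
    (x : M) (v u w : TangentSpace 𝓘(ℝ, E) x) : TangentSpace 𝓘(ℝ, E) x :=
  D (fun y ↦ B y (extend E u y) (extend E w y)) x v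
    - B x (D (extend E u) x v) w - B x u (D (extend E w) x v)

/-- The covariant derivative `(D_v θ)(w)` of a one-form. -/
def covForm (D : (Π x : M, TangentSpace 𝓘(ℝ, E) x) →
      Π x : M, TangentSpace 𝓘(ℝ, E) x → TangentSpace 𝓘(ℝ, E) x)
    (θ : Π x : M, TangentSpace 𝓘(ℝ, E) x → ℝ)
    (x : M) (v w : TangentSpace 𝓘(ℝ, E) x) : ℝ :=
  d% (fun y ↦ θ y (extend E w y)) x v - θ x (D (extend E w) x v)

/-- The covariant derivative `(D_v b)(u, w)` of a `(0,2)`-tensor field. -/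
def covForm₂ (D : (Π x : M, TangentSpace 𝓘(ℝ, E) x) →
      Π x : M, TangentSpace 𝓘(ℝ, E) x → TangentSpace 𝓘(ℝ, E) x)
    (b : Π x : M, TangentSpace 𝓘(ℝ, E) x → TangentSpace 𝓘(ℝ, E) x → ℝ)
    (x : M) (v u w : TangentSpace 𝓘(ℝ, E) x) : ℝ :=
  d% (fun y ↦ b y (extend E u y) (extend E w y)) x v
    - b x (D (extend E u) x v) w - b x u (D (extend E w) x v)

/-- The covariant derivative `(D_v c)(u, w, z)` of a `(0,3)`-tensor field. -/
def covForm₃ (D : (Π x : M, TangentSpace 𝓘(ℝ, E) x) →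
      Π x : M, TangentSpace 𝓘(ℝ, E) x → TangentSpace 𝓘(ℝ, E) x)
    (c : Π x : M, TangentSpace 𝓘(ℝ, E) x → TangentSpace 𝓘(ℝ, E) x →
      TangentSpace 𝓘(ℝ, E) x → ℝ)
    (x : M) (v u w z : TangentSpace 𝓘(ℝ, E) x) : ℝ :=
  d% (fun y ↦ c y (extend E u y) (extend E w y) (extend E z y)) x v
    - c x (D (extend E u) x v) w z - c x u (D (extend E w) x v) z - c x u w (D (extend E z) x v)

/-- The Levi-Civita connection as a plain map. -/
def nabla (Y : Π x : M, TangentSpace 𝓘(ℝ, E) x) (x : M) (v : TangentSpace 𝓘(ℝ, E) x) :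
    TangentSpace 𝓘(ℝ, E) x :=
  leviCivita Y x v

/-- An orthonormal basis of the tangent space. All the sums over it below are traces of bilinear
expressions, so they do not depend on which basis is taken. -/
def orthoFrame (x : M) : OrthonormalBasis (Fin (finrank ℝ (TangentSpace 𝓘(ℝ, E) x))) ℝ
    (TangentSpace 𝓘(ℝ, E) x) :=
  stdOrthonormalBasis ℝ (TangentSpace 𝓘(ℝ, E) x)

/-- The rough Laplacian `∇*∇ Y = -∑ᵢ (∇²Y)(eᵢ, eᵢ)` of a vector field. -/
def roughLapVec (Y : Π x : M, TangentSpace 𝓘(ℝ, E) x) (x : M) : TangentSpace 𝓘(ℝ, E) x :=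
  -∑ i, covEnd nabla (nabla Y) x (orthoFrame x i) (orthoFrame x i)

/-- The rough Laplacian `(∇*∇ A) w = -∑ᵢ (∇²A)(eᵢ, eᵢ) w` of a `(1,1)`-tensor field. -/
def roughLapEnd (A : Π x : M, TangentSpace 𝓘(ℝ, E) x → TangentSpace 𝓘(ℝ, E) x)
    (x : M) (w : TangentSpace 𝓘(ℝ, E) x) : TangentSpace 𝓘(ℝ, E) x :=
  -∑ i, covEnd₂ nabla (covEnd nabla A) x (orthoFrame x i) (orthoFrame x i) w

/-- The rough Laplacian of a one-form. -/
def roughLapForm (θ : Π x : M, TangentSpace 𝓘(ℝ, E) x → ℝ)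
    (x : M) (w : TangentSpace 𝓘(ℝ, E) x) : ℝ :=
  -∑ i, covForm₂ nabla (covForm nabla θ) x (orthoFrame x i) (orthoFrame x i) w

/-- The rough Laplacian of a `(0,2)`-tensor field. -/
def roughLapForm₂ (b : Π x : M, TangentSpace 𝓘(ℝ, E) x → TangentSpace 𝓘(ℝ, E) x → ℝ)
    (x : M) (v w : TangentSpace 𝓘(ℝ, E) x) : ℝ :=
  -∑ i, covForm₃ nabla (covForm₂ nabla b) x (orthoFrame x i) (orthoFrame x i) v w

/-- The pointwise squared norm `‖∇Y‖² = ∑ᵢ ‖∇_{eᵢ} Y‖²`. -/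
def normSqNabla (Y : Π x : M, TangentSpace 𝓘(ℝ, E) x) (x : M) : ℝ :=
  ∑ i, ‖nabla Y x (orthoFrame x i)‖ ^ 2

/-- A unit vector field `Y` is a harmonic unit vector field: `∇*∇Y = ‖∇Y‖² Y`. -/
def IsHarmonicUnitVectorField (Y : Π x : M, TangentSpace 𝓘(ℝ, E) x) : Prop :=
  (∀ x, ‖Y x‖ = 1) ∧ ∀ x, roughLapVec Y x = normSqNabla Y x • Y x

/-- The wedge product of two covectors, `α ∧ β = α ⊗ β - β ⊗ α`. -/
def wedge {V : Type*} (α β : V → ℝ) (v w : V) : ℝ := α v * β w - α w * β v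

/-- The action of an endomorphism on covectors as a derivation, `(A·θ)(w) = -θ(A w)`. -/
def actForm {V : Type*} (A : V → V) (θ : V → ℝ) (w : V) : ℝ := -θ (A w)

variable (E M) in
/-- An almost contact metric structure `(φ, ζ)` on the Riemannian manifold `M`. -/
structure AlmostContactMetricStructure where
  /-- The `(1,1)`-tensor field `φ`. -/
  phi : Π x : M, TangentSpace 𝓘(ℝ, E) x →L[ℝ] TangentSpace 𝓘(ℝ, E) x
  /-- The characteristic vector field `ζ`. -/
  zeta : Π x : M, TangentSpace 𝓘(ℝ, E) x
  contMDiff_phi : ContMDiff 𝓘(ℝ, E) (𝓘(ℝ, E).prod 𝓘(ℝ, E →L[ℝ] E)) ∞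
    (fun x ↦ TotalSpace.mk' (E →L[ℝ] E)
      (E := fun x : M ↦ TangentSpace 𝓘(ℝ, E) x →L[ℝ] TangentSpace 𝓘(ℝ, E) x) x (phi x))
  contMDiff_zeta : ContMDiff 𝓘(ℝ, E) (𝓘(ℝ, E).prod 𝓘(ℝ, E)) ∞
    (fun x ↦ TotalSpace.mk' E (E := fun x : M ↦ TangentSpace 𝓘(ℝ, E) x) x (zeta x))
  inner_zeta_zeta : ∀ x, inner ℝ (zeta x) (zeta x) = 1
  phi_phi : ∀ x v, phi x (phi x v) = -v + inner ℝ (zeta x) v • zeta x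
  inner_phi_phi : ∀ x v w, inner ℝ (phi x v) (phi x w) =
    inner ℝ v w - inner ℝ (zeta x) v * inner ℝ (zeta x) w

namespace AlmostContactMetricStructure

variable (S : AlmostContactMetricStructure E M)

/-- `φ` as a family of plain maps. -/
def phiMap (x : M) (v : TangentSpace 𝓘(ℝ, E) x) : TangentSpace 𝓘(ℝ, E) x := S.phi x v

/-- The one-form `η = ζ^♭`. -/
def eta (x : M) (v : TangentSpace 𝓘(ℝ, E) x) : ℝ := inner ℝ (S.zeta x) v

/-- The fundamental two-form `F(v, w) = ⟪v, φ w⟫`. -/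
def fundForm (x : M) (v w : TangentSpace 𝓘(ℝ, E) x) : ℝ := inner ℝ v (S.phi x w)

/-- The projection `v ↦ v - η(v) ζ` onto `ζ^⊥`. -/
def horiz (x : M) (v : TangentSpace 𝓘(ℝ, E) x) : TangentSpace 𝓘(ℝ, E) x :=
  v - S.eta x v • S.zeta x

/-- The two-form `b` at `x` lies in `u(n)`, that is, `b ∈ Λ²η^⊥` and
`b(φ v, φ w) = b(v_{ζ^⊥}, w_{ζ^⊥})`. -/
structure IsUnitaryForm (x : M) (b : LinearMap.BilinForm ℝ (TangentSpace 𝓘(ℝ, E) x)) : Prop where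
  skew : ∀ v w, b v w = -b w v
  zeta_left : ∀ w, b (S.zeta x) w = 0
  phi_phi : ∀ v w, b (S.phi x v) (S.phi x w) = b (S.horiz x v) (S.horiz x w)

/-- The endomorphism `A` of the tangent space at `x` lies in `u(n)`: its two-form
`(v, w) ↦ ⟪v, A w⟫` does. -/
def IsUnitaryEnd (x : M) (A : TangentSpace 𝓘(ℝ, E) x →ₗ[ℝ] TangentSpace 𝓘(ℝ, E) x) : Prop :=
  ∃ b : LinearMap.BilinForm ℝ (TangentSpace 𝓘(ℝ, E) x),
    S.IsUnitaryForm x b ∧ ∀ v w, b v w = inner ℝ v (A w)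

/-- The two-form `b` at `x` lies in `u(n)^⊥ = u(n)^⊥|_{ζ^⊥} ⊕ η^⊥ ∧ η`, that is,
`b(φ v, φ w) = -b(v_{ζ^⊥}, w_{ζ^⊥})`. -/
structure IsUnitaryPerpForm (x : M)
    (b : TangentSpace 𝓘(ℝ, E) x → TangentSpace 𝓘(ℝ, E) x → ℝ) : Prop where
  skew : ∀ v w, b v w = -b w v
  phi_phi : ∀ v w, b (S.phi x v) (S.phi x w) = -b (S.horiz x v) (S.horiz x w)

/-- The element `a^♭ ⊗ ζ - η ⊗ a` of `ζ^⊥_c`, for a vector `a` orthogonal to `ζ`. -/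
def zetaPerp (x : M) (a w : TangentSpace 𝓘(ℝ, E) x) : TangentSpace 𝓘(ℝ, E) x :=
  (inner ℝ a w : ℝ) • S.zeta x - S.eta x w • a

/-- The `U(n)`-intrinsic torsion,
`ξ_v = -½ φ ∘ ∇_v φ + ∇_v η ⊗ ζ - ½ η ⊗ ∇_v ζ`; here `S.torsion x v w` is `ξ_v w`.
It is the only tensor such that `ξ_v` takes values in `u(n)^⊥` and `∇ + ξ` is a `U(n)`-connection:
see `torsion_mem`, `minConn_zeta`, `covEnd_minConn_phi` and `torsion_unique` below. -/
def torsion (x : M) (v w : TangentSpace 𝓘(ℝ, E) x) : TangentSpace 𝓘(ℝ, E) x :=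
  -(1 / 2 : ℝ) • S.phi x (covEnd nabla S.phiMap x v w)
    + covForm nabla S.eta x v w • S.zeta x
    - ((1 / 2 : ℝ) * S.eta x w) • nabla S.zeta x v

/-- The minimal connection `∇^{U(n)} = ∇ + ξ`. -/
def minConn (Y : Π x : M, TangentSpace 𝓘(ℝ, E) x) (x : M) (v : TangentSpace 𝓘(ℝ, E) x) :
    TangentSpace 𝓘(ℝ, E) x :=
  nabla Y x v + S.torsion x v (Y x)

/-- The coderivative `d*ξ = -∑ᵢ (∇_{eᵢ} ξ)_{eᵢ}`. -/
def codiffTorsion (x : M) (w : TangentSpace 𝓘(ℝ, E) x) : TangentSpace 𝓘(ℝ, E) x :=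
  -∑ i, covEnd₂ nabla S.torsion x (orthoFrame x i) (orthoFrame x i) w

/-- The structure is harmonic: `d*ξ = 0`. -/
def IsHarmonic : Prop := ∀ x w, S.codiffTorsion x w = 0

/-- The endomorphism `∑ᵢ (∇^{U(n)}_{eᵢ} ξ)_{eᵢ}`. -/
def divTorsion (x : M) (w : TangentSpace 𝓘(ℝ, E) x) : TangentSpace 𝓘(ℝ, E) x :=
  ∑ i, covEnd₂ S.minConn S.torsion x (orthoFrame x i) (orthoFrame x i) w

/-- The endomorphism `∑ᵢ ξ_{ξ_{eᵢ} eᵢ}`. -/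
def torsionTrace (x : M) (w : TangentSpace 𝓘(ℝ, E) x) : TangentSpace 𝓘(ℝ, E) x :=
  ∑ i, S.torsion x (S.torsion x (orthoFrame x i) (orthoFrame x i)) w

/-- The vector `∑ᵢ ξ_{eᵢ} ξ_{eᵢ} ζ`. -/
def torsionSqZeta (x : M) : TangentSpace 𝓘(ℝ, E) x :=
  ∑ i, S.torsion x (orthoFrame x i) (S.torsion x (orthoFrame x i) (S.zeta x))

/-- The one-form `∑ᵢ ξ_{eᵢ}(ξ_{eᵢ} η)`. -/
def torsionSqEta (x : M) (w : TangentSpace 𝓘(ℝ, E) x) : ℝ :=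
  ∑ i, actForm (S.torsion x (orthoFrame x i)) (actForm (S.torsion x (orthoFrame x i)) (S.eta x)) w

/-- The structure is of type `C₅ ⊕ ⋯ ⊕ C₁₀ ⊕ C₁₂`: the intrinsic torsion is a section of
`T*M ⊗ (η^⊥ ∧ η) = (η^⊥ ⊗ η^⊥ ∧ η) ⊕ (η ⊗ η^⊥ ∧ η)`. -/
def IsTypeC5ToC10C12 : Prop :=
  ∀ x v, ∃ a, S.eta x a = 0 ∧ ∀ w, S.torsion x v w = S.zetaPerp x a w

/-! ### The intrinsic torsion is characterised by its defining property -/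

theorem phi_zeta (x : M) : S.phi x (S.zeta x) = 0 := by
  have h := S.inner_phi_phi x (S.zeta x) (S.zeta x)
  rw [S.inner_zeta_zeta] at h
  exact inner_self_eq_zero.1 (by linarith : inner ℝ (S.phi x (S.zeta x)) (S.phi x (S.zeta x)) = 0)

theorem inner_zeta_phi (x : M) (v : TangentSpace 𝓘(ℝ, E) x) :
    inner ℝ (S.zeta x) (S.phi x v) = 0 := by
  have h := S.inner_phi_phi x (S.zeta x) (S.phi x v)
  rw [S.phi_zeta, inner_zero_left, S.inner_zeta_zeta] at h
  have h2 := S.phi_phi x (S.phi x v)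
  have h3 := congrArg (S.phi x) (S.phi_phi x v)
  rw [map_add, map_smul, S.phi_zeta, map_neg, smul_zero, add_zero, h2] at h3
  have h4 : inner ℝ (S.zeta x) (S.phi x v) • S.zeta x = 0 := by
    simpa using h3
  have h5 := congrArg (fun u ↦ inner ℝ (S.zeta x) u) h4
  simp only [inner_smul_right, S.inner_zeta_zeta, inner_zero_right, mul_one] at h5
  exact h5

theorem inner_phi_left (x : M) (v w : TangentSpace 𝓘(ℝ, E) x) :
    inner ℝ (S.phi x v) w = -inner ℝ v (S.phi x w) := by
  have h := S.inner_phi_phi x (S.phi x v) w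
  rw [S.phi_phi, S.inner_zeta_phi, inner_add_left, inner_neg_left, inner_smul_left,
    S.inner_zeta_phi] at h
  simp at h
  linarith

theorem mdifferentiableAt_zeta (x : M) : MDiffAt (T% S.zeta) x :=
  (S.contMDiff_zeta x).mdifferentiableAt (by simp)

variable {W : Π x : M, TangentSpace 𝓘(ℝ, E) x} {x : M}

theorem mdifferentiableAt_phi (hW : MDiffAt (T% W) x) :
    MDiffAt (T% (fun y ↦ S.phi y (W y))) x :=
  MDifferentiableAt.clm_bundle_apply (F₁ := E) (F₂ := E)
    (E₁ := fun x : M ↦ TangentSpace 𝓘(ℝ, E) x) (E₂ := fun x : M ↦ TangentSpace 𝓘(ℝ, E) x)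
    ((S.contMDiff_phi x).mdifferentiableAt (by simp)) hW

theorem nabla_add {Y Y' : Π x : M, TangentSpace 𝓘(ℝ, E) x} (hY : MDiffAt (T% Y) x)
    (hY' : MDiffAt (T% Y') x) (v : TangentSpace 𝓘(ℝ, E) x) :
    nabla (Y + Y') x v = nabla Y x v + nabla Y' x v := by
  simp only [nabla]
  rw [leviCivita.isCovariantDerivativeOn.add (s := Set.univ) hY hY']; rfl

theorem nabla_smul {Y : Π x : M, TangentSpace 𝓘(ℝ, E) x} {f : M → ℝ} (hf : MDiffAt f x)
    (hY : MDiffAt (T% Y) x) (v : TangentSpace 𝓘(ℝ, E) x) :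
    nabla (f • Y) x v = f x • nabla Y x v + d% f x v • Y x := by
  simp only [nabla]
  rw [leviCivita.isCovariantDerivativeOn.leibniz (s := Set.univ) hY hf]; rfl

theorem covEnd_phi (hW : MDiffAt (T% W) x) (v : TangentSpace 𝓘(ℝ, E) x) :
    covEnd nabla S.phiMap x v (W x) =
      nabla (fun y ↦ S.phi y (W y)) x v - S.phi x (nabla W x v) := by
  have T : TensorialAt 𝓘(ℝ, E) E (fun W : Π x : M, TangentSpace 𝓘(ℝ, E) x ↦
      nabla (fun y ↦ S.phi y (W y)) x v - S.phi x (nabla W x v)) x :=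
    { smul := fun {f W} hf hW ↦ by
        have e : (fun y ↦ S.phi y ((f • W) y)) = f • fun y ↦ S.phi y (W y) := by
          funext y; simp
        simp only [e]
        rw [nabla_smul hf (S.mdifferentiableAt_phi hW), nabla_smul hf hW]
        simp [smul_sub]
      add := fun {W W'} hW hW' ↦ by
        have e : (fun y ↦ S.phi y ((W + W') y)) =
            (fun y ↦ S.phi y (W y)) + fun y ↦ S.phi y (W' y) := by
          funext y; simp
        simp only [e]
        rw [nabla_add (S.mdifferentiableAt_phi hW) (S.mdifferentiableAt_phi hW'),
          nabla_add hW hW', map_add]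
        abel }
  exact T.pointwise (mdifferentiableAt_extend 𝓘(ℝ, E) E (W x)) hW (by simp)

theorem covForm_eta (v w : TangentSpace 𝓘(ℝ, E) x) :
    covForm nabla S.eta x v w = inner ℝ (nabla S.zeta x v) w := by
  simp only [covForm, eta]
  rw [leviCivita_metric (S.mdifferentiableAt_zeta x) (mdifferentiableAt_extend 𝓘(ℝ, E) E w)]
  simp [nabla]

theorem inner_zeta_nabla_zeta (v : TangentSpace 𝓘(ℝ, E) x) :
    inner ℝ (S.zeta x) (nabla S.zeta x v) = 0 := by
  have h := leviCivita_metric (S.mdifferentiableAt_zeta x) (S.mdifferentiableAt_zeta x) v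
  have e : (fun y ↦ inner ℝ (S.zeta y) (S.zeta y)) = fun _ ↦ (1 : ℝ) :=
    funext S.inner_zeta_zeta
  have e' : d% (fun _ : M ↦ (1 : ℝ)) x v = 0 := by simp [mvfderiv]
  rw [e, e', real_inner_comm] at h
  simp only [nabla]
  linarith

theorem covEnd_phi_zeta (v : TangentSpace 𝓘(ℝ, E) x) :
    covEnd nabla S.phiMap x v (S.zeta x) = -S.phi x (nabla S.zeta x v) := by
  rw [S.covEnd_phi (S.mdifferentiableAt_zeta x)]
  have e : (fun y ↦ S.phi y (S.zeta y)) = (0 : Π x : M, TangentSpace 𝓘(ℝ, E) x) :=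
    funext S.phi_zeta
  rw [e]
  simp [nabla]

theorem inner_covEnd_phi (v w u : TangentSpace 𝓘(ℝ, E) x) :
    inner ℝ (covEnd nabla S.phiMap x v w) u = -inner ℝ w (covEnd nabla S.phiMap x v u) := by
  have hw := mdifferentiableAt_extend 𝓘(ℝ, E) E w
  have hu := mdifferentiableAt_extend 𝓘(ℝ, E) E u
  have h1 := leviCivita_metric (S.mdifferentiableAt_phi hw) hu v
  have h2 := leviCivita_metric hw (S.mdifferentiableAt_phi hu) v
  have e : (fun y ↦ inner ℝ (S.phi y (extend E w y)) (extend E u y)) =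
      -fun y ↦ inner ℝ (extend E w y) (S.phi y (extend E u y)) :=
    funext fun y ↦ S.inner_phi_left y _ _
  have e2 : d% (-fun y ↦ inner ℝ (extend E w y) (S.phi y (extend E u y))) x v =
      -d% (fun y ↦ inner ℝ (extend E w y) (S.phi y (extend E u y))) x v := by
    rw [mvfderiv_neg]; rfl
  rw [e, e2, h2] at h1
  simp only [extend_apply_self] at h1
  simp only [covEnd, nabla, phiMap, inner_sub_left, inner_sub_right]
  rw [S.inner_phi_left]
  have h3 := S.inner_phi_left x w (leviCivita (extend E u) x v)
  linarith

theorem covEnd_phi_phi (v w : TangentSpace 𝓘(ℝ, E) x) :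
    covEnd nabla S.phiMap x v (S.phi x w) + S.phi x (covEnd nabla S.phiMap x v w) =
      (inner ℝ (nabla S.zeta x v) w : ℝ) • S.zeta x
        + (inner ℝ (S.zeta x) w : ℝ) • nabla S.zeta x v := by
  have hw := mdifferentiableAt_extend 𝓘(ℝ, E) E w
  have h1 := S.covEnd_phi hw v
  have h2 := S.covEnd_phi (S.mdifferentiableAt_phi hw) v
  simp only [extend_apply_self] at h1 h2
  have e : (fun y ↦ S.phi y (S.phi y (extend E w y))) =
      (fun _ : M ↦ (-1 : ℝ)) • extend E w
        + (fun y : M ↦ (inner ℝ (S.zeta y) (extend E w y) : ℝ)) • S.zeta := by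
    funext y; simp [S.phi_phi]
  have hz := S.mdifferentiableAt_zeta x
  have hf := mdifferentiableAt_inner hz hw
  have hc : MDiffAt (fun _ : M ↦ (-1 : ℝ)) x := mdifferentiableAt_const
  have e' : d% (fun _ : M ↦ (-1 : ℝ)) x v = 0 := by simp [mvfderiv]
  rw [e, nabla_add (hc.smul_section hw) (hf.smul_section hz), nabla_smul hc hw,
    nabla_smul hf hz, e', leviCivita_metric hz hw] at h2
  rw [h1, h2, map_sub, S.phi_phi]
  simp only [extend_apply_self, nabla]
  module

theorem inner_zeta_covEnd_phi (v w : TangentSpace 𝓘(ℝ, E) x) :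
    inner ℝ (S.zeta x) (covEnd nabla S.phiMap x v w) = -inner ℝ (nabla S.zeta x v) (S.phi x w) := by
  have h := S.inner_covEnd_phi v (S.zeta x) w
  rw [S.covEnd_phi_zeta, inner_neg_left, S.inner_phi_left] at h
  linarith

/-- `ξ_v` takes values in `u(n)^⊥`. -/
theorem torsion_mem (x : M) (v : TangentSpace 𝓘(ℝ, E) x) :
    S.IsUnitaryPerpForm x (fun w u ↦ inner ℝ w (S.torsion x v u)) where
  skew w u := by
    have h := congrArg (fun z ↦ inner ℝ w z) (S.covEnd_phi_phi v u)
    have h1 := S.inner_phi_left x u (covEnd nabla S.phiMap x v w)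
    have h2 := S.inner_covEnd_phi v (S.phi x u) w
    simp only [inner_add_right, inner_smul_right] at h
    simp only [torsion, S.covForm_eta, eta, inner_add_right, inner_sub_right, inner_smul_right]
    have c1 := real_inner_comm w (covEnd nabla S.phiMap x v (S.phi x u))
    have c2 := real_inner_comm w (S.zeta x)
    have c3 := real_inner_comm u (S.zeta x)
    have c4 := real_inner_comm u (nabla S.zeta x v)
    have c5 := real_inner_comm w (nabla S.zeta x v)
    simp only [c2, c3, c4, c5] at h ⊢
    linarith
  phi_phi w u := by
    have h := congrArg (fun z ↦ inner ℝ w z) (S.covEnd_phi_phi v u)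
    simp only [inner_add_right, inner_smul_right] at h
    have c2 := real_inner_comm w (S.zeta x)
    have c5 := real_inner_comm w (nabla S.zeta x v)
    have z2 : inner ℝ (S.phi x w) (S.zeta x) = 0 := by
      rw [real_inner_comm, S.inner_zeta_phi]
    have zz : ∀ y, inner ℝ (nabla S.zeta x v) (S.phi x (S.phi x y)) =
        -inner ℝ (nabla S.zeta x v) y := fun y ↦ by
      rw [S.phi_phi, inner_add_right, inner_smul_right, real_inner_comm (S.zeta x),
        S.inner_zeta_nabla_zeta]
      simp
    have l1 : inner ℝ (S.phi x w) (S.torsion x v (S.phi x u)) =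
        -(1 / 2) * (inner ℝ w (covEnd nabla S.phiMap x v (S.phi x u))
          - inner ℝ (S.zeta x) w * inner ℝ (nabla S.zeta x v) u) := by
      simp only [torsion, S.covForm_eta, eta, inner_add_right, inner_sub_right, inner_smul_right,
        S.inner_phi_phi, S.inner_zeta_phi, S.inner_zeta_covEnd_phi, z2, zz]
      ring
    have hz1 : ∀ y, inner ℝ (S.horiz x w) (S.phi x y) = inner ℝ w (S.phi x y) := fun y ↦ by
      simp [horiz, inner_sub_left, inner_smul_left, S.inner_zeta_phi]
    have hz2 : inner ℝ (S.horiz x w) (S.zeta x) = 0 := by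
      simp only [horiz, eta, inner_sub_left, inner_smul_left, S.inner_zeta_zeta, c2]
      simp
    have hz3 : inner ℝ (S.zeta x) (S.horiz x u) = 0 := by
      simp only [horiz, eta, inner_sub_right, inner_smul_right, S.inner_zeta_zeta]
      ring
    have k1 := S.inner_phi_left x w (covEnd nabla S.phiMap x v (S.horiz x u))
    have k2 := S.inner_covEnd_phi v (S.phi x w) (S.horiz x u)
    have k3 : inner ℝ (covEnd nabla S.phiMap x v (S.phi x w)) (S.horiz x u) =
        inner ℝ (covEnd nabla S.phiMap x v (S.phi x w)) u
          - inner ℝ (S.zeta x) u * inner ℝ (nabla S.zeta x v) w := by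
      simp only [horiz, eta, inner_sub_right, inner_smul_right]
      rw [real_inner_comm (S.zeta x), S.inner_zeta_covEnd_phi, zz]
      ring
    have k4 := S.inner_covEnd_phi v (S.phi x w) u
    have k5 := S.inner_phi_left x w (covEnd nabla S.phiMap x v u)
    have l2 : inner ℝ (S.horiz x w) (S.torsion x v (S.horiz x u)) =
        -(1 / 2) * inner ℝ w (S.phi x (covEnd nabla S.phiMap x v (S.horiz x u))) := by
      simp only [torsion, S.covForm_eta, eta, inner_add_right, inner_sub_right, inner_smul_right,
        hz1, hz2, hz3]
      ring
    simp only [l1, l2]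
    simp only [c5] at h k3
    rw [c2]
    linarith

/-- The minimal connection makes `ζ` parallel. -/
theorem minConn_zeta (x : M) (v : TangentSpace 𝓘(ℝ, E) x) : S.minConn S.zeta x v = 0 := by
  have h : inner ℝ (nabla S.zeta x v) (S.zeta x) = 0 := by
    rw [real_inner_comm, S.inner_zeta_nabla_zeta]
  simp only [minConn, torsion, S.covEnd_phi_zeta, S.covForm_eta, eta, S.inner_zeta_zeta,
    map_neg, S.phi_phi, S.inner_zeta_nabla_zeta, h]
  module

theorem covEnd_minConn_phi_eq (v w : TangentSpace 𝓘(ℝ, E) x) :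
    covEnd S.minConn S.phiMap x v w =
      covEnd nabla S.phiMap x v w + (S.torsion x v (S.phi x w) - S.phi x (S.torsion x v w)) := by
  simp only [covEnd, minConn, phiMap, map_add, extend_apply_self]
  abel

/-- The minimal connection makes `φ` parallel. -/
theorem covEnd_minConn_phi (x : M) (v w : TangentSpace 𝓘(ℝ, E) x) :
    covEnd S.minConn S.phiMap x v w = 0 := by
  have h : covEnd nabla S.phiMap x v (S.phi x w) =
      (inner ℝ (nabla S.zeta x v) w : ℝ) • S.zeta x
        + (inner ℝ (S.zeta x) w : ℝ) • nabla S.zeta x v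
        - S.phi x (covEnd nabla S.phiMap x v w) := by
    rw [← S.covEnd_phi_phi]; abel
  rw [covEnd_minConn_phi_eq]
  simp only [torsion, S.covForm_eta, eta, h, map_add, map_sub, map_smul, S.phi_zeta, S.phi_phi,
    S.inner_zeta_phi, S.inner_zeta_covEnd_phi]
  module

/-- The intrinsic torsion is the only tensor with values in `u(n)^⊥` for which `∇ + ξ` makes `φ` and
`ζ` parallel. -/
theorem torsion_unique (x : M) (v : TangentSpace 𝓘(ℝ, E) x)
    (A : TangentSpace 𝓘(ℝ, E) x →ₗ[ℝ] TangentSpace 𝓘(ℝ, E) x)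
    (hA : S.IsUnitaryPerpForm x (fun w u ↦ inner ℝ w (A u)))
    (hzeta : nabla S.zeta x v + A (S.zeta x) = 0)
    (hphi : ∀ w, covEnd nabla S.phiMap x v w + (A (S.phi x w) - S.phi x (A w)) = 0)
    (w : TangentSpace 𝓘(ℝ, E) x) :
    A w = S.torsion x v w := by
  have hz : S.torsion x v (S.zeta x) = A (S.zeta x) := by
    have h := S.minConn_zeta x v
    simp only [minConn] at h
    exact add_left_cancel (h.trans hzeta.symm)
  have hT := S.torsion_mem x v
  have hC : ∀ u, A (S.phi x u) - S.torsion x v (S.phi x u) =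
      S.phi x (A u) - S.phi x (S.torsion x v u) := fun u ↦ by
    have h1 := S.covEnd_minConn_phi x v u
    rw [covEnd_minConn_phi_eq] at h1
    have h2 := add_left_cancel (h1.trans (hphi u).symm)
    have h3 : A (S.phi x u) - S.torsion x v (S.phi x u) - (S.phi x (A u) - S.phi x (S.torsion x v u))
        = 0 := by
      rw [sub_sub_sub_comm, ← h2, sub_self]
    exact sub_eq_zero.1 h3
  have sk : ∀ p q, inner ℝ p (A q - S.torsion x v q) = -inner ℝ q (A p - S.torsion x v p) :=
    fun p q ↦ by
      have h1 := hA.skew p q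
      have h2 := hT.skew p q
      rw [inner_sub_right, inner_sub_right, h1, h2]
      ring
  have sz : ∀ q, inner ℝ (S.zeta x) (A q - S.torsion x v q) = 0 := fun q ↦ by
    rw [sk, hz]; simp
  have hh : ∀ p q, inner ℝ (S.horiz x p) (A q - S.torsion x v q) =
      inner ℝ p (A q - S.torsion x v q) := fun p q ↦ by
    rw [horiz, inner_sub_left, inner_smul_left, sz]; simp
  have key : ∀ p, inner ℝ p (A w - S.torsion x v w) = 0 := fun p ↦ by
    have h1 := hA.phi_phi p w
    have h2 := hT.phi_phi p w
    have h3 : inner ℝ (S.phi x p) (A (S.phi x w) - S.torsion x v (S.phi x w)) =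
        -inner ℝ (S.horiz x p) (A (S.horiz x w) - S.torsion x v (S.horiz x w)) := by
      rw [inner_sub_right, inner_sub_right, h1, h2]
      ring
    rw [hC, ← map_sub, S.inner_phi_phi, sz, hh, sk p (S.horiz x w), hh, sk w p] at h3
    linarith
  exact sub_eq_zero.1 (inner_self_eq_zero.1 (key _))

end AlmostContactMetricStructure

end

end

/-! Everything is governed by one endomorphism at each point, `C = ∑ᵢ (∇_{eᵢ} ξ)_{eᵢ} = -d*ξ`
(`divTorsionEnd`), and the theorem lists ways of detecting that `C` vanishes.

First, `C` lies in `u(n)^⊥`. Passing from `∇` to `∇ + ξ` changes `(∇_{eᵢ} ξ)_{eᵢ}` by a commutator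
of `ξ_{eᵢ}` with itself, which is zero, and by `-ξ_{ξ_{eᵢ} eᵢ}`. Hence `C` is the trace of `∇^{U(n)}
ξ` plus `∑ᵢ ξ_{ξ_{eᵢ} eᵢ}`; both stay in `u(n)^⊥`, because `∇^{U(n)}` preserves the structure
(`isUnitaryPerpEnd_divTorsionEnd`). This also gives the last condition.

Second, `∇φ = [φ, ξ]` and `∇ζ = -ξζ`. Differentiating once more and tracing gives `∇*∇φ = [C, φ] +
Q` and `∇*∇ζ = C ζ + q`, with `Q = -∑ᵢ [ξ_{eᵢ}, [ξ_{eᵢ}, φ]]` and `q = -∑ᵢ ξ_{eᵢ} ξ_{eᵢ} ζ`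
(`isLaplacianDecomposition`). The statements for `F` and `η` are the metric duals.

The rest is linear algebra. An element of `u(n)^⊥` is `N` plus an element of `ζ^⊥_c`, with `N`
anticommuting with `φ`. So `C = 0` exactly when `C ζ = 0`, that is `∇*∇ζ = q`, and `N = 0`. The
horizontal part of `[C, φ]` is `-2 φ N`, which anticommutes with `φ`, while that of `Q` commutes
with it. Thus `N = 0` exactly when the horizontal part of `∇*∇φ` commutes with `φ`, and the
commutator identities only add the mixed `ζ`-component of `Q`.

If `ξ` takes values in `ζ^⊥_c`, then `φ ξ φ = 0`; applying `∇^{U(n)}` gives `N = 0` for free, so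
only `C ζ = 0` is left, and there `q = ‖∇ζ‖² ζ`. -/

section
-- Differentiability of the Levi-Civita derivative of a smooth field.
variable {E : Type*} [NormedAddCommGroup E] [NormedSpace ℝ E] [FiniteDimensional ℝ E]
  {M : Type*} [TopologicalSpace M] [ChartedSpace E M] [IsManifold 𝓘(ℝ, E) ∞ M]

/-- Near each point there is a smooth frame of the tangent bundle, and the coefficients of a
differentiable vector field with respect to it are differentiable. -/
theorem exists_smooth_frame (x : M) :
    ∃ (s : Fin (finrank ℝ E) → Π y : M, TangentSpace 𝓘(ℝ, E) y)
      (c : Fin (finrank ℝ E) → Π y : M, TangentSpace 𝓘(ℝ, E) y →ₗ[ℝ] ℝ),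
      (∀ i, CMDiffAt ∞ (T% (s i)) x) ∧
      (∀ i (W : Π y : M, TangentSpace 𝓘(ℝ, E) y), MDiffAt (T% W) x →
        MDiffAt (fun y ↦ c i y (W y)) x) ∧
      (∀ᶠ y in 𝓝 x, ∀ v, v = ∑ i, c i y v • s i y) ∧
      (∀ᶠ y in 𝓝 x, ∀ i, c i y (s i y) = 1) ∧
      ∀ᶠ y in 𝓝 x, LinearIndependent ℝ (fun i ↦ s i y) := by
  let t := trivializationAt E (TangentSpace 𝓘(ℝ, E)) x
  let b := finBasis ℝ E
  have x_mem : x ∈ t.baseSet := FiberBundle.mem_baseSet_trivializationAt E _ x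
  have hF := t.isLocalFrameOn_localFrame_baseSet 𝓘(ℝ, E) 1 b
  have hev : ∀ᶠ y in 𝓝 x, y ∈ t.baseSet := t.open_baseSet.mem_nhds x_mem
  refine ⟨t.localFrame b, t.localFrameCoeff 𝓘(ℝ, E) b,
    fun i ↦ contMDiffAt_localFrame_of_mem ∞ _ b i x_mem,
    fun i W hW ↦ mdifferentiableAt_localFrameCoeff b x_mem hW i, ?_, ?_, ?_⟩
  · classical
    filter_upwards [hev] with y hy v
    have h := t.eq_sum_localFrameCoeff_smul (I := 𝓘(ℝ, E)) (b := b)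
      (s := fun z ↦ if h : z = y then h ▸ v else 0) hy
    simpa using h
  · filter_upwards [hev] with y hy i
    rw [t.localFrameCoeff_eq_coeff hy]
    simp [t.localFrame_apply_of_mem_baseSet b hy, Trivialization.basisAt, t.apply_mk_symm hy]
  · filter_upwards [hev] with y hy
    exact hF.linearIndependent hy

theorem eventually_mdifferentiableAt {Y : Π y : M, TangentSpace 𝓘(ℝ, E) y} {x : M}
    (hY : CMDiffAt ∞ (T% Y) x) : ∀ᶠ y in 𝓝 x, MDiffAt (T% Y) y := by
  -- Order `∞` at a point does not spread to a neighbourhood, but each finite order does; order 1 is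
  -- enough.
  have h : CMDiffAt 1 (T% Y) x := hY.of_le (by simp)
  filter_upwards [(contMDiffAt_iff_contMDiffAt_nhds (by simp)).1 h] with y hy
  exact hy.mdifferentiableAt (by simp)

/-- A family of linear maps that takes smooth vector fields to differentiable ones takes
differentiable vector fields to differentiable ones. -/
theorem mdifferentiableAt_linear_map {x : M}
    {A : Π y : M, TangentSpace 𝓘(ℝ, E) y → TangentSpace 𝓘(ℝ, E) y}
    (hlin : ∀ᶠ y in 𝓝 x, IsLinearMap ℝ (A y))
    (hA : ∀ W : Π y : M, TangentSpace 𝓘(ℝ, E) y, CMDiffAt ∞ (T% W) x →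
      MDiffAt (T% (fun y ↦ A y (W y))) x)
    {W : Π y : M, TangentSpace 𝓘(ℝ, E) y} (hW : MDiffAt (T% W) x) :
    MDiffAt (T% (fun y ↦ A y (W y))) x := by
  -- With `W = ∑ cᵢ(W) sᵢ`, linearity gives `A W = ∑ cᵢ(W) A sᵢ`, so `A` only has to be tested on
  -- the smooth frame.
  obtain ⟨s, c, hs, hc, hsum, -, -⟩ := exists_smooth_frame (E := E) x
  have h : MDiffAt (T% (fun y ↦ ∑ i, ((fun y ↦ c i y (W y)) • fun y ↦ A y (s i y)) y)) x :=
    MDifferentiableAt.sum_section fun i _ ↦ (hc i W hW).smul_section (hA _ (hs i))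
  refine h.congr_of_eventuallyEq ?_
  filter_upwards [hsum, hlin] with y hy hl
  have e : A y (W y) = ∑ i, ((fun y ↦ c i y (W y)) • fun y ↦ A y (s i y)) y := by
    conv_lhs => rw [hy (W y)]
    rw [show A y = hl.mk' (A y) from rfl, map_sum]
    simp
  simp only [e]

theorem contMDiffAt_mlieBracket {X Y : Π y : M, TangentSpace 𝓘(ℝ, E) y} {x : M}
    (hX : CMDiffAt ∞ (T% X) x) (hY : CMDiffAt ∞ (T% Y) x) :
    CMDiffAt 1 (T% (VectorField.mlieBracket 𝓘(ℝ, E) X Y)) x := by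
  -- The bracket of `C^2` fields is `C^1`, on a manifold of class `C^3`.
  have : IsManifold 𝓘(ℝ, E) (((2 : ℕ∞) : ℕ∞ω) + 1) M := IsManifold.of_le (n := ∞) (by
    rw [show ((2 : ℕ∞) : ℕ∞ω) + 1 = ((3 : ℕ∞) : ℕ∞ω) from rfl]
    exact_mod_cast le_top)
  have : IsManifold 𝓘(ℝ, E) (minSmoothness ℝ 2) M := by
    simp only [minSmoothness_of_isRCLikeNormedField]
    infer_instance
  exact ContMDiffAt.mlieBracket_vectorField (n := 2) (m := 1) (hX.of_le (by exact_mod_cast le_top))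
    (hY.of_le (by exact_mod_cast le_top)) (by simp; norm_num)

/-- The derivative of a smooth function along a differentiable vector field is differentiable. -/
theorem mdifferentiableAt_mvfderiv_apply {x : M} {f : M → ℝ} (hf : CMDiffAt ∞ f x)
    {V : Π y : M, TangentSpace 𝓘(ℝ, E) y} (hV : MDiffAt (T% V) x) :
    MDiffAt (fun y ↦ d% f y (V y)) x := by
  obtain ⟨s, c, hs, hc, hsum, hone, -⟩ := exists_smooth_frame (E := E) x
  have hf1 : CMDiffAt 1 f x := hf.of_le (by simp)
  have hfe : ∀ᶠ y in 𝓝 x, MDiffAt f y := by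
    filter_upwards [(contMDiffAt_iff_contMDiffAt_nhds (by simp)).1 hf1] with y hy
    exact hy.mdifferentiableAt (by simp)
  -- Since `[s, f s] = df(s) s`, the function `df(sᵢ)` is the `i`-th frame coefficient of a `C^1`
  -- field; no chart expression of `df` is needed.
  have key : ∀ i, MDiffAt (fun y ↦ d% f y (s i y)) x := fun i ↦ by
    have hb : CMDiffAt 1 (T% (VectorField.mlieBracket 𝓘(ℝ, E) (s i) (f • s i))) x :=
      contMDiffAt_mlieBracket (hs i) (hf.smul_section (hs i))
    refine (hc i _ (hb.mdifferentiableAt (by simp))).congr_of_eventuallyEq ?_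
    filter_upwards [hfe, eventually_mdifferentiableAt (hs i), hone] with y hfy hsy hy
    rw [VectorField.mlieBracket_smul_right hfy hsy]
    simp [hy i]
  have h : MDiffAt (∑ i, (fun y ↦ c i y (V y)) * fun y ↦ d% f y (s i y)) x :=
    MDifferentiableAt.sum fun i _ ↦ (hc i V hV).mul (key i)
  refine h.congr_of_eventuallyEq ?_
  filter_upwards [hsum] with y hy
  conv_lhs => rw [hy (V y)]
  simp

theorem contMDiffAt_det {ι : Type*} [Fintype ι] [DecidableEq ι] {x : M}
    {A : M → Matrix ι ι ℝ} (hA : ∀ i j, CMDiffAt ∞ (fun y ↦ A y i j) x) :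
    CMDiffAt ∞ (fun y ↦ (A y).det) x := by
  simp only [Matrix.det_apply']
  exact contMDiffAt_finsetSum fun σ _ ↦
    contMDiffAt_const.mul (contMDiffAt_finsetProd fun i _ ↦ hA _ _)

/-- Cramer's rule: an entry of the inverse is a cofactor divided by the determinant, and both are
polynomial in the entries. -/
theorem contMDiffAt_matrix_inv {ι : Type*} [Fintype ι] [DecidableEq ι] {x : M}
    {A : M → Matrix ι ι ℝ} (hA : ∀ i j, CMDiffAt ∞ (fun y ↦ A y i j) x)
    (hdet : (A x).det ≠ 0) (i j : ι) :
    CMDiffAt ∞ (fun y ↦ (A y)⁻¹ i j) x := by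
  simp only [Matrix.inv_def, Ring.inverse_eq_inv', Matrix.smul_apply, smul_eq_mul,
    Matrix.adjugate_apply]
  refine ((contMDiffAt_det hA).inv₀ hdet).mul (contMDiffAt_det fun k l ↦ ?_)
  by_cases hk : k = j
  · subst hk
    simpa using contMDiffAt_const
  · simpa [Matrix.updateRow_ne hk] using hA k l

variable [RiemannianBundle (fun x : M ↦ TangentSpace 𝓘(ℝ, E) x)]
  [IsContMDiffRiemannianBundle 𝓘(ℝ, E) ∞ E (fun x : M ↦ TangentSpace 𝓘(ℝ, E) x)]
  {x : M}

theorem contMDiffAt_inner {X Y : Π y : M, TangentSpace 𝓘(ℝ, E) y}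
    (hX : CMDiffAt ∞ (T% X) x) (hY : CMDiffAt ∞ (T% Y) x) :
    CMDiffAt ∞ (fun y ↦ inner ℝ (X y) (Y y)) x :=
  ContMDiffAt.inner_bundle (E := fun x : M ↦ TangentSpace 𝓘(ℝ, E) x) (F := E) hX hY

/-- A vector field is differentiable if its inner products with smooth fields are. -/
theorem mdifferentiableAt_of_inner {X : Π y : M, TangentSpace 𝓘(ℝ, E) y}
    (hX : ∀ Z : Π y : M, TangentSpace 𝓘(ℝ, E) y, CMDiffAt ∞ (T% Z) x →
      MDiffAt (fun y ↦ inner ℝ (X y) (Z y)) x) : MDiffAt (T% X) x := by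
  obtain ⟨s, c, hs, hc, hsum, -, hlin⟩ := exists_smooth_frame (E := E) x
  let G : M → Matrix (Fin (finrank ℝ E)) (Fin (finrank ℝ E)) ℝ :=
    fun y ↦ Matrix.gram ℝ fun i ↦ s i y
  have hdet : ∀ᶠ y in 𝓝 x, (G y).det ≠ 0 := by
    filter_upwards [hlin] with y hy
    exact Matrix.det_gram_ne_zero_iff_linearIndependent.2 hy
  have hG : ∀ i j, CMDiffAt ∞ (fun y ↦ G y i j) x := fun i j ↦ by
    simpa only [G, Matrix.gram_apply] using contMDiffAt_inner (hs i) (hs j)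
  have hinv := contMDiffAt_matrix_inv hG hdet.self_of_nhds
  have h : MDiffAt (T% (fun y ↦ ∑ i,
      ((fun y ↦ (∑ j, (fun y ↦ inner ℝ (X y) (s j y)) * fun y ↦ (G y)⁻¹ j i) y) • s i) y)) x :=
    MDifferentiableAt.sum_section fun i _ ↦ (MDifferentiableAt.sum fun j _ ↦
      (hX _ (hs j)).mul ((hinv j i).mdifferentiableAt (by simp))).smul_section
        ((hs i).mdifferentiableAt (by simp))
  refine h.congr_of_eventuallyEq ?_
  filter_upwards [hsum, hdet] with y hy hd
  -- The inverse Gram matrix turns the inner products of `X` with the frame into its frame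
  -- coefficients.
  have e : ∀ i, ∑ j, inner ℝ (X y) (s j y) * (G y)⁻¹ j i = c i y (X y) := fun i ↦ by
    have h1 : ∀ j, inner ℝ (X y) (s j y) = ∑ k, c k y (X y) * G y k j := fun j ↦ by
      conv_lhs => rw [hy (X y)]
      simp [sum_inner, inner_smul_left, G, Matrix.gram_apply]
    have h2 := congrFun (congrArg (Matrix.vecMul (fun k ↦ c k y (X y)))
      (Matrix.mul_nonsing_inv (G y) (isUnit_iff_ne_zero.2 hd))) i
    rw [← Matrix.vecMul_vecMul, Matrix.vecMul_one] at h2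
    rw [← h2]
    simp only [h1]
    rfl
  have e2 : X y = ∑ i,
      ((fun y ↦ (∑ j, (fun y ↦ inner ℝ (X y) (s j y)) * fun y ↦ (G y)⁻¹ j i) y) • s i) y := by
    conv_lhs => rw [hy (X y)]
    simp [e]
  simp only [e2]

/-- The Levi-Civita derivative of a smooth vector field along a differentiable one is
differentiable. -/
theorem mdifferentiableAt_nabla {Y V : Π y : M, TangentSpace 𝓘(ℝ, E) y}
    (hY : CMDiffAt ∞ (T% Y) x) (hV : MDiffAt (T% V) x) :
    MDiffAt (T% (fun y ↦ nabla Y y (V y))) x := by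
  refine mdifferentiableAt_linear_map (A := fun y ↦ nabla Y y)
    (Filter.Eventually.of_forall fun y ↦ ⟨map_add _, map_smul _⟩) (fun V hV ↦ ?_) hV
  -- For smooth `Y`, `V`, `Z` the Koszul formula contains only derivatives of smooth functions and
  -- inner products with brackets of smooth fields.
  refine mdifferentiableAt_of_inner fun Z hZ ↦ ?_
  have br {P Q R : Π y : M, TangentSpace 𝓘(ℝ, E) y} (hP : CMDiffAt ∞ (T% P) x)
      (hQ : CMDiffAt ∞ (T% Q) x) (hR : CMDiffAt ∞ (T% R) x) :
      MDiffAt (fun y ↦ inner ℝ (VectorField.mlieBracket 𝓘(ℝ, E) P Q y) (R y)) x := by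
    have hb : CMDiffAt 1 (T% (VectorField.mlieBracket 𝓘(ℝ, E) P Q)) x :=
      contMDiffAt_mlieBracket hP hQ
    exact mdifferentiableAt_inner (hb.mdifferentiableAt (by simp))
      (hR.mdifferentiableAt (by simp))
  have dr {P Q R : Π y : M, TangentSpace 𝓘(ℝ, E) y} (hP : CMDiffAt ∞ (T% P) x)
      (hQ : CMDiffAt ∞ (T% Q) x) (hR : CMDiffAt ∞ (T% R) x) :
      MDiffAt (fun y ↦ d% (fun z ↦ inner ℝ (P z) (Q z)) y (R y)) x :=
    mdifferentiableAt_mvfderiv_apply (contMDiffAt_inner hP hQ) (hR.mdifferentiableAt (by simp))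
  have hc : MDiffAt (fun _ : M ↦ (1 / 2 : ℝ)) x := mdifferentiableAt_const
  have h : MDiffAt (fun y ↦ koszul Y V Z y) x :=
    hc.mul ((((((dr hY hZ hV).add (dr hZ hV hY)).sub (dr hV hY hZ)).add (br hV hY hZ)).sub
      (br hY hZ hV)).add (br hZ hV hY))
  refine h.congr_of_eventuallyEq ?_
  filter_upwards [eventually_mdifferentiableAt hY, eventually_mdifferentiableAt hV,
    eventually_mdifferentiableAt hZ] with y h1 h2 h3
  exact leviCivita_koszul h1 h2 h3

end

/-! ### The intrinsic torsion as a differentiable tensor, and its covariant derivatives. -/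

section
variable {E : Type*} [NormedAddCommGroup E] [NormedSpace ℝ E] [FiniteDimensional ℝ E]
  {M : Type*} [TopologicalSpace M] [ChartedSpace E M] [IsManifold 𝓘(ℝ, E) ∞ M]
  [RiemannianBundle (fun x : M ↦ TangentSpace 𝓘(ℝ, E) x)]
  [IsContMDiffRiemannianBundle 𝓘(ℝ, E) ∞ E (fun x : M ↦ TangentSpace 𝓘(ℝ, E) x)]
  {x : M}

/-- The covariant derivative of a differentiable `(1,2)`-tensor field can be computed with arbitrary
differentiable vector fields. -/
theorem covEnd₂_apply {v : TangentSpace 𝓘(ℝ, E) x}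
    {D : (Π x : M, TangentSpace 𝓘(ℝ, E) x) →
      Π x : M, TangentSpace 𝓘(ℝ, E) x → TangentSpace 𝓘(ℝ, E) x}
    (hadd : ∀ {Y Y' : Π x : M, TangentSpace 𝓘(ℝ, E) x}, MDiffAt (T% Y) x → MDiffAt (T% Y') x →
      D (Y + Y') x v = D Y x v + D Y' x v)
    (hsmul : ∀ {Y : Π x : M, TangentSpace 𝓘(ℝ, E) x} {f : M → ℝ}, MDiffAt f x →
      MDiffAt (T% Y) x → D (f • Y) x v = f x • D Y x v + d% f x v • Y x)
    {B : Π x : M, TangentSpace 𝓘(ℝ, E) x → TangentSpace 𝓘(ℝ, E) x → TangentSpace 𝓘(ℝ, E) x}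
    (hl : ∀ y w, IsLinearMap ℝ (fun u ↦ B y u w)) (hr : ∀ y u, IsLinearMap ℝ (B y u))
    (hB : ∀ {U W : Π x : M, TangentSpace 𝓘(ℝ, E) x}, MDiffAt (T% U) x → MDiffAt (T% W) x →
      MDiffAt (T% (fun y ↦ B y (U y) (W y))) x)
    {U W : Π x : M, TangentSpace 𝓘(ℝ, E) x} (hU : MDiffAt (T% U) x) (hW : MDiffAt (T% W) x) :
    covEnd₂ D B x v (U x) (W x) =
      D (fun y ↦ B y (U y) (W y)) x v - B x (D U x v) (W x) - B x (U x) (D W x v) := by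
  have ha1 : ∀ y p q w, B y (p + q) w = B y p w + B y q w := fun y p q w ↦ (hl y w).map_add p q
  have hs1 : ∀ y c p w, B y (c • p) w = c • B y p w := fun y c p w ↦ (hl y w).map_smul c p
  have ha2 : ∀ y u p q, B y u (p + q) = B y u p + B y u q := fun y u p q ↦ (hr y u).map_add p q
  have hs2 : ∀ y c u p, B y u (c • p) = c • B y u p := fun y c u p ↦ (hr y u).map_smul c p
  let Φ : (Π x : M, TangentSpace 𝓘(ℝ, E) x) → (Π x : M, TangentSpace 𝓘(ℝ, E) x) →
      TangentSpace 𝓘(ℝ, E) x := fun U W ↦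
    D (fun y ↦ B y (U y) (W y)) x v - B x (D U x v) (W x) - B x (U x) (D W x v)
  -- In either slot the `d% f` term from differentiating `B` cancels the one from differentiating
  -- the argument. So only values at `x` matter and the chosen extensions may be replaced.
  have h1 : ∀ W : Π x : M, TangentSpace 𝓘(ℝ, E) x, MDiffAt (T% W) x →
      TensorialAt 𝓘(ℝ, E) E (Φ · W) x := fun W hW ↦
    { smul := fun {f U} hf hU ↦ by
        have e : (fun y ↦ B y ((f • U) y) (W y)) = f • fun y ↦ B y (U y) (W y) := by
          funext y; simp [hs1]
        simp only [Φ, e]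
        rw [hsmul hf (hB hU hW), hsmul hf hU, ha1, hs1, hs1, Pi.smul_apply', hs1]
        module
      add := fun {U U'} hU hU' ↦ by
        have e : (fun y ↦ B y ((U + U') y) (W y)) =
            (fun y ↦ B y (U y) (W y)) + fun y ↦ B y (U' y) (W y) := by
          funext y; simp [ha1]
        simp only [Φ, e]
        rw [hadd (hB hU hW) (hB hU' hW), hadd hU hU', Pi.add_apply, ha1, ha1]
        abel }
  have h2 : ∀ U : Π x : M, TangentSpace 𝓘(ℝ, E) x, MDiffAt (T% U) x →
      TensorialAt 𝓘(ℝ, E) E (Φ U ·) x := fun U hU ↦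
    { smul := fun {f W} hf hW ↦ by
        have e : (fun y ↦ B y (U y) ((f • W) y)) = f • fun y ↦ B y (U y) (W y) := by
          funext y; simp [hs2]
        simp only [Φ, e]
        rw [hsmul hf (hB hU hW), hsmul hf hW, ha2, hs2, hs2, Pi.smul_apply', hs2]
        module
      add := fun {W W'} hW hW' ↦ by
        have e : (fun y ↦ B y (U y) ((W + W') y)) =
            (fun y ↦ B y (U y) (W y)) + fun y ↦ B y (U y) (W' y) := by
          funext y; simp [ha2]
        simp only [Φ, e]
        rw [hadd (hB hU hW) (hB hU hW'), hadd hW hW', Pi.add_apply, ha2, ha2]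
        abel }
  have h := TensorialAt.pointwise₂ (Φ := Φ) h1 h2
    (mdifferentiableAt_extend 𝓘(ℝ, E) E (U x)) hU (mdifferentiableAt_extend 𝓘(ℝ, E) E (W x)) hW
    (by simp) (by simp)
  simpa [Φ, covEnd₂] using h

namespace AlmostContactMetricStructure

variable (S : AlmostContactMetricStructure E M)

theorem isLinearMap_covEnd_phi_left (x : M) (w : TangentSpace 𝓘(ℝ, E) x) :
    IsLinearMap ℝ (fun v ↦ covEnd nabla S.phiMap x v w) where
  map_add v v' := by
    simp only [covEnd, nabla, phiMap, map_add]
    abel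
  map_smul c v := by
    simp only [covEnd, nabla, phiMap, map_smul, smul_sub]

/-- Tensoriality (`covEnd_phi`) allows the sum of the two extensions in place of the extension of
the sum, and likewise for multiples. -/
theorem isLinearMap_covEnd_phi (x : M) (v : TangentSpace 𝓘(ℝ, E) x) :
    IsLinearMap ℝ (covEnd nabla S.phiMap x v) where
  map_add w w' := by
    have hw := mdifferentiableAt_extend 𝓘(ℝ, E) E w
    have hw' := mdifferentiableAt_extend 𝓘(ℝ, E) E w'
    have h1 := S.covEnd_phi hw v
    have h2 := S.covEnd_phi hw' v
    have h := S.covEnd_phi (mdifferentiableAt_add_section hw hw') v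
    have e : (fun y ↦ S.phi y ((extend E w + extend E w') y)) =
        (fun y ↦ S.phi y (extend E w y)) + fun y ↦ S.phi y (extend E w' y) := by
      funext y; simp
    rw [e, nabla_add (S.mdifferentiableAt_phi hw) (S.mdifferentiableAt_phi hw'),
      nabla_add hw hw'] at h
    simp only [Pi.add_apply, extend_apply_self] at h h1 h2
    rw [h, h1, h2, map_add]
    abel
  map_smul c w := by
    have hw := mdifferentiableAt_extend 𝓘(ℝ, E) E w
    have hc : MDiffAt (fun _ : M ↦ c) x := mdifferentiableAt_const
    have h1 := S.covEnd_phi hw v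
    have h := S.covEnd_phi (hc.smul_section hw) v
    have e : (fun y ↦ S.phi y (((fun _ : M ↦ c) • extend E w) y)) =
        (fun _ : M ↦ c) • (fun y ↦ S.phi y (extend E w y)) := by
      funext y; simp
    rw [e, nabla_smul hc (S.mdifferentiableAt_phi hw), nabla_smul hc hw, mvfderiv_const] at h
    simp only [Pi.smul_apply', extend_apply_self, zero_apply, zero_smul, add_zero] at h h1
    rw [h, h1, map_smul, smul_sub]

theorem isLinearMap_torsion_left (x : M) (w : TangentSpace 𝓘(ℝ, E) x) :
    IsLinearMap ℝ (fun v ↦ S.torsion x v w) where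
  map_add v v' := by
    have h := (S.isLinearMap_covEnd_phi_left x w).map_add v v'
    simp only [torsion, S.covForm_eta, h, nabla, map_add, inner_add_left]
    module
  map_smul c v := by
    have h := (S.isLinearMap_covEnd_phi_left x w).map_smul c v
    simp only [torsion, S.covForm_eta, h, nabla, map_smul, inner_smul_left, RCLike.conj_to_real]
    module

theorem isLinearMap_torsion (x : M) (v : TangentSpace 𝓘(ℝ, E) x) :
    IsLinearMap ℝ (S.torsion x v) where
  map_add w w' := by
    simp only [torsion, S.covForm_eta, (S.isLinearMap_covEnd_phi x v).map_add, map_add, eta,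
      inner_add_right]
    module
  map_smul c w := by
    simp only [torsion, S.covForm_eta, (S.isLinearMap_covEnd_phi x v).map_smul, map_smul, eta,
      inner_smul_right]
    module

theorem contMDiffAt_phi {W : Π x : M, TangentSpace 𝓘(ℝ, E) x} (hW : CMDiffAt ∞ (T% W) x) :
    CMDiffAt ∞ (T% (fun y ↦ S.phi y (W y))) x :=
  ContMDiffAt.clm_bundle_apply (F₁ := E) (F₂ := E)
    (E₁ := fun x : M ↦ TangentSpace 𝓘(ℝ, E) x) (E₂ := fun x : M ↦ TangentSpace 𝓘(ℝ, E) x)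
    (S.contMDiff_phi x) hW

variable {U W : Π x : M, TangentSpace 𝓘(ℝ, E) x}

/-- `mdifferentiableAt_nabla` needs a smooth field under `∇`; linearity in `W` reduces to that case,
where the expression is `∇(φ W) - φ ∇W`. -/
theorem mdifferentiableAt_covEnd_phi (hU : MDiffAt (T% U) x) (hW : MDiffAt (T% W) x) :
    MDiffAt (T% (fun y ↦ covEnd nabla S.phiMap y (U y) (W y))) x := by
  refine mdifferentiableAt_linear_map (A := fun y ↦ covEnd nabla S.phiMap y (U y))
    (Filter.Eventually.of_forall fun y ↦ S.isLinearMap_covEnd_phi y (U y)) (fun W hW ↦ ?_) hW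
  have h : MDiffAt (T% ((fun y ↦ nabla (fun z ↦ S.phi z (W z)) y (U y)) -
      fun y ↦ S.phi y (nabla W y (U y)))) x :=
    mdifferentiableAt_sub_section (mdifferentiableAt_nabla (S.contMDiffAt_phi hW) hU)
      (S.mdifferentiableAt_phi (mdifferentiableAt_nabla hW hU))
  refine h.congr_of_eventuallyEq ?_
  filter_upwards [eventually_mdifferentiableAt hW] with y hy
  simp only [S.covEnd_phi hy, Pi.sub_apply]

theorem mdifferentiableAt_torsion (hU : MDiffAt (T% U) x) (hW : MDiffAt (T% W) x) :
    MDiffAt (T% (fun y ↦ S.torsion y (U y) (W y))) x := by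
  have hz := S.mdifferentiableAt_zeta x
  have hn : MDiffAt (T% (fun y ↦ nabla S.zeta y (U y))) x :=
    mdifferentiableAt_nabla (S.contMDiff_zeta x) hU
  have hc : MDiffAt (fun _ : M ↦ -(1 / 2 : ℝ)) x := mdifferentiableAt_const
  have hc' : MDiffAt (fun _ : M ↦ (1 / 2 : ℝ)) x := mdifferentiableAt_const
  have h1 := hc.smul_section (S.mdifferentiableAt_phi (S.mdifferentiableAt_covEnd_phi hU hW))
  have h2 := (mdifferentiableAt_inner hn hW).smul_section hz
  have h3 := (hc'.mul (mdifferentiableAt_inner hz hW)).smul_section hn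
  have h := mdifferentiableAt_sub_section (mdifferentiableAt_add_section h1 h2) h3
  refine h.congr_of_eventuallyEq (Filter.Eventually.of_forall fun y ↦ ?_)
  simp [torsion, S.covForm_eta, eta]

theorem inner_torsion (v p q : TangentSpace 𝓘(ℝ, E) x) :
    inner ℝ p (S.torsion x v q) = -inner ℝ (S.torsion x v p) q := by
  rw [(S.torsion_mem x v).skew, real_inner_comm]

theorem horiz_eq (v : TangentSpace 𝓘(ℝ, E) x) : S.horiz x v = -S.phi x (S.phi x v) := by
  simp only [horiz, eta, S.phi_phi]
  abel

/-- Membership in `u(n)^⊥` rewritten through compositions with `φ` only, using `horiz = -φ²`. In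
this form it can be differentiated by a connection for which `φ` is parallel. -/
theorem phi_torsion_phi (v w : TangentSpace 𝓘(ℝ, E) x) :
    S.phi x (S.torsion x v (S.phi x w)) =
      S.phi x (S.phi x (S.torsion x v (S.phi x (S.phi x w)))) := by
  refine ext_inner_left ℝ fun p ↦ ?_
  have h := (S.torsion_mem x v).phi_phi p w
  have e : S.torsion x v (-S.phi x (S.phi x w)) = -S.torsion x v (S.phi x (S.phi x w)) :=
    (S.isLinearMap_torsion x v).map_neg _
  rw [S.inner_phi_left, S.horiz_eq, S.horiz_eq, e, inner_neg_left, inner_neg_right,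
    S.inner_phi_left, S.inner_phi_left] at h
  linarith

theorem nabla_zeta_eq (v : TangentSpace 𝓘(ℝ, E) x) :
    nabla S.zeta x v = -S.torsion x v (S.zeta x) :=
  eq_neg_of_add_eq_zero_left (S.minConn_zeta x v)

theorem covEnd_phi_eq (v w : TangentSpace 𝓘(ℝ, E) x) :
    covEnd nabla S.phiMap x v w = S.phi x (S.torsion x v w) - S.torsion x v (S.phi x w) := by
  have h := S.covEnd_minConn_phi x v w
  rw [covEnd_minConn_phi_eq] at h
  rw [eq_neg_of_add_eq_zero_left h, neg_sub]

theorem minConn_add (hU : MDiffAt (T% U) x) (hW : MDiffAt (T% W) x)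
    (v : TangentSpace 𝓘(ℝ, E) x) :
    S.minConn (U + W) x v = S.minConn U x v + S.minConn W x v := by
  simp only [minConn, nabla_add hU hW, Pi.add_apply, (S.isLinearMap_torsion x v).map_add]
  abel

theorem minConn_smul {f : M → ℝ} (hf : MDiffAt f x) (hU : MDiffAt (T% U) x)
    (v : TangentSpace 𝓘(ℝ, E) x) :
    S.minConn (f • U) x v = f x • S.minConn U x v + d% f x v • U x := by
  simp only [minConn, nabla_smul hf hU, Pi.smul_apply', (S.isLinearMap_torsion x v).map_smul]
  module

theorem minConn_phi (hW : MDiffAt (T% W) x) (v : TangentSpace 𝓘(ℝ, E) x) :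
    S.minConn (fun y ↦ S.phi y (W y)) x v = S.phi x (S.minConn W x v) := by
  have h := S.covEnd_phi hW v
  rw [S.covEnd_phi_eq] at h
  simp only [minConn, map_add]
  rw [eq_add_of_sub_eq h.symm]
  abel

theorem covEnd₂_nabla_torsion (hU : MDiffAt (T% U) x) (hW : MDiffAt (T% W) x)
    (v : TangentSpace 𝓘(ℝ, E) x) :
    covEnd₂ nabla S.torsion x v (U x) (W x) =
      nabla (fun y ↦ S.torsion y (U y) (W y)) x v - S.torsion x (nabla U x v) (W x)
        - S.torsion x (U x) (nabla W x v) :=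
  covEnd₂_apply (fun h h' ↦ nabla_add h h' v) (fun h h' ↦ nabla_smul h h' v)
    S.isLinearMap_torsion_left S.isLinearMap_torsion S.mdifferentiableAt_torsion hU hW

theorem covEnd₂_minConn_torsion (hU : MDiffAt (T% U) x) (hW : MDiffAt (T% W) x)
    (v : TangentSpace 𝓘(ℝ, E) x) :
    covEnd₂ S.minConn S.torsion x v (U x) (W x) =
      S.minConn (fun y ↦ S.torsion y (U y) (W y)) x v - S.torsion x (S.minConn U x v) (W x)
        - S.torsion x (U x) (S.minConn W x v) :=
  covEnd₂_apply (fun h h' ↦ S.minConn_add h h' v) (fun h h' ↦ S.minConn_smul h h' v)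
    S.isLinearMap_torsion_left S.isLinearMap_torsion S.mdifferentiableAt_torsion hU hW

/-- The difference of the connections is `ξ`, acting on the value and on both arguments of the
tensor `ξ`. For `u = v` the two double products cancel. -/
theorem covEnd₂_minConn_torsion_eq (v u w : TangentSpace 𝓘(ℝ, E) x) :
    covEnd₂ S.minConn S.torsion x v u w = covEnd₂ nabla S.torsion x v u w
      + S.torsion x v (S.torsion x u w) - S.torsion x (S.torsion x v u) w
      - S.torsion x u (S.torsion x v w) := by
  have h := (S.isLinearMap_torsion_left x w).map_add
  simp only [covEnd₂, minConn, extend_apply_self, h, (S.isLinearMap_torsion x u).map_add]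
  abel

theorem isLinearMap_covEnd₂_nabla_torsion (v u : TangentSpace 𝓘(ℝ, E) x) :
    IsLinearMap ℝ (covEnd₂ nabla S.torsion x v u) where
  map_add w w' := by
    have hu := mdifferentiableAt_extend 𝓘(ℝ, E) E u
    have hw := mdifferentiableAt_extend 𝓘(ℝ, E) E w
    have hw' := mdifferentiableAt_extend 𝓘(ℝ, E) E w'
    have h1 := S.covEnd₂_nabla_torsion hu hw v
    have h2 := S.covEnd₂_nabla_torsion hu hw' v
    have h := S.covEnd₂_nabla_torsion hu (mdifferentiableAt_add_section hw hw') v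
    have e : (fun y ↦ S.torsion y (extend E u y) ((extend E w + extend E w') y)) =
        (fun y ↦ S.torsion y (extend E u y) (extend E w y)) +
          fun y ↦ S.torsion y (extend E u y) (extend E w' y) := by
      funext y; simp [(S.isLinearMap_torsion y _).map_add]
    rw [e, nabla_add (S.mdifferentiableAt_torsion hu hw) (S.mdifferentiableAt_torsion hu hw'),
      nabla_add hw hw'] at h
    simp only [Pi.add_apply, extend_apply_self, (S.isLinearMap_torsion x _).map_add] at h h1 h2
    rw [h, h1, h2]
    abel
  map_smul c w := by
    have hu := mdifferentiableAt_extend 𝓘(ℝ, E) E u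
    have hw := mdifferentiableAt_extend 𝓘(ℝ, E) E w
    have hc : MDiffAt (fun _ : M ↦ c) x := mdifferentiableAt_const
    have h1 := S.covEnd₂_nabla_torsion hu hw v
    have h := S.covEnd₂_nabla_torsion hu (hc.smul_section hw) v
    have e : (fun y ↦ S.torsion y (extend E u y) (((fun _ : M ↦ c) • extend E w) y)) =
        (fun _ : M ↦ c) • (fun y ↦ S.torsion y (extend E u y) (extend E w y)) := by
      funext y; simp [(S.isLinearMap_torsion y _).map_smul]
    rw [e, nabla_smul hc (S.mdifferentiableAt_torsion hu hw), nabla_smul hc hw,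
      mvfderiv_const] at h
    simp only [Pi.smul_apply', extend_apply_self, zero_apply, zero_smul, add_zero,
      (S.isLinearMap_torsion x _).map_smul] at h h1
    rw [h, h1, smul_sub, smul_sub]

/-- A metric connection preserves skewness: this is the derivative of `inner_torsion`. -/
theorem inner_covEnd₂_nabla_torsion (v u p q : TangentSpace 𝓘(ℝ, E) x) :
    inner ℝ p (covEnd₂ nabla S.torsion x v u q) =
      -inner ℝ (covEnd₂ nabla S.torsion x v u p) q := by
  have hu := mdifferentiableAt_extend 𝓘(ℝ, E) E u
  have hp := mdifferentiableAt_extend 𝓘(ℝ, E) E p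
  have hq := mdifferentiableAt_extend 𝓘(ℝ, E) E q
  have h1 := leviCivita_metric hp (S.mdifferentiableAt_torsion hu hq) v
  have h2 := leviCivita_metric (S.mdifferentiableAt_torsion hu hp) hq v
  have e : (fun y ↦ inner ℝ (extend E p y) (S.torsion y (extend E u y) (extend E q y))) =
      -fun y ↦ inner ℝ (S.torsion y (extend E u y) (extend E p y)) (extend E q y) :=
    funext fun y ↦ S.inner_torsion _ _ _
  rw [e, mvfderiv_neg, neg_apply, h2] at h1
  simp only [extend_apply_self] at h1
  simp only [covEnd₂, nabla, inner_sub_left, inner_sub_right]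
  have i1 := S.inner_torsion u (leviCivita (extend E p) x v) q
  have i2 := S.inner_torsion u p (leviCivita (extend E q) x v)
  have i3 := S.inner_torsion (leviCivita (extend E u) x v) p q
  linarith

/-- As `φ` is parallel, it can be moved inside the derivative. The right-hand side involves the
differentiated tensor only through `φ ξ φ`, so it vanishes as soon as that composition does. -/
theorem phi_covEnd₂_minConn_torsion_phi (v u w : TangentSpace 𝓘(ℝ, E) x) :
    S.phi x (covEnd₂ S.minConn S.torsion x v u (S.phi x w)) =
      S.minConn (fun y ↦ S.phi y (S.torsion y (extend E u y) (S.phi y (extend E w y)))) x v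
        - S.phi x (S.torsion x (S.minConn (extend E u) x v) (S.phi x w))
        - S.phi x (S.torsion x u (S.phi x (S.minConn (extend E w) x v))) := by
  have hu := mdifferentiableAt_extend 𝓘(ℝ, E) E u
  have hw := mdifferentiableAt_extend 𝓘(ℝ, E) E w
  have h := S.covEnd₂_minConn_torsion hu (S.mdifferentiableAt_phi hw) v
  rw [S.minConn_phi hw] at h
  simp only [extend_apply_self] at h
  rw [h, S.minConn_phi (S.mdifferentiableAt_torsion hu (S.mdifferentiableAt_phi hw)),
    map_sub, map_sub]

/-- The `∇^{U(n)}`-derivative of `phi_torsion_phi`: derivatives of `ξ` for the minimal connection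
remain in `u(n)^⊥`. -/
theorem phi_phi_covEnd₂_minConn_torsion_phi_phi (v u w : TangentSpace 𝓘(ℝ, E) x) :
    S.phi x (S.phi x (covEnd₂ S.minConn S.torsion x v u (S.phi x (S.phi x w)))) =
      S.phi x (covEnd₂ S.minConn S.torsion x v u (S.phi x w)) := by
  have hu := mdifferentiableAt_extend 𝓘(ℝ, E) E u
  have hw := mdifferentiableAt_extend 𝓘(ℝ, E) E w
  have hpw := S.mdifferentiableAt_phi hw
  have hppw := S.mdifferentiableAt_phi hpw
  have ht := S.mdifferentiableAt_torsion hu hppw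
  have h := S.covEnd₂_minConn_torsion hu hppw v
  rw [S.minConn_phi hpw, S.minConn_phi hw] at h
  simp only [extend_apply_self] at h
  rw [h, map_sub, map_sub, map_sub, map_sub, ← S.minConn_phi ht,
    ← S.minConn_phi (S.mdifferentiableAt_phi ht), S.phi_covEnd₂_minConn_torsion_phi]
  simp only [← S.phi_torsion_phi]

end AlmostContactMetricStructure
end

/-! ### Linear algebra of `u(n)^⊥` for one almost contact metric vector space. -/

section
variable {V : Type*} [NormedAddCommGroup V] [InnerProductSpace ℝ V]

/-- A linear almost contact metric structure on an inner product space. -/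
structure IsAlmostContactMetric (φ : V →ₗ[ℝ] V) (ζ : V) : Prop where
  inner_zeta_zeta : inner ℝ ζ ζ = 1
  phi_phi : ∀ v, φ (φ v) = -v + inner ℝ ζ v • ζ
  phi_zeta : φ ζ = 0
  inner_zeta_phi : ∀ v, inner ℝ ζ (φ v) = 0
  inner_phi_left : ∀ v w, inner ℝ (φ v) w = -inner ℝ v (φ w)

/-- A skew endomorphism in the orthogonal complement of the unitary algebra of an almost contact
metric structure. -/
structure IsUnitaryPerpEnd (φ B : V →ₗ[ℝ] V) : Prop where
  skew : ∀ v w, inner ℝ v (B w) = -inner ℝ (B v) w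
  perp : ∀ w, φ (φ (B (φ (φ w)))) = φ (B (φ w))

/-- The endomorphism `-[B, [B, φ]]`. -/
noncomputable def negDoubleCommutator (φ B : V →ₗ[ℝ] V) : V →ₗ[ℝ] V :=
  (2 : ℝ) • (B ∘ₗ φ ∘ₗ B) - B ∘ₗ B ∘ₗ φ - φ ∘ₗ B ∘ₗ B

theorem negDoubleCommutator_apply (φ B : V →ₗ[ℝ] V) (w : V) :
    negDoubleCommutator φ B w = (2 : ℝ) • B (φ (B w)) - B (B (φ w)) - φ (B (B w)) := rfl

variable {φ : V →ₗ[ℝ] V} {ζ : V}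

/-- Elements of `u(n)^⊥` are sums of an endomorphism anticommuting with `φ` and an element of
`ζ^⊥_c`. -/
theorem IsUnitaryPerpEnd.decomposition (h : IsAlmostContactMetric φ ζ) {B : V →ₗ[ℝ] V}
    (hB : IsUnitaryPerpEnd φ B) :
    ∃ N : V →ₗ[ℝ] V, (∀ w, N w = φ (B (φ w))) ∧ (∀ w, N (φ w) = -φ (N w)) ∧ N ζ = 0 ∧
      (∀ w, inner ℝ ζ (N w) = 0) ∧ (∀ v w, inner ℝ (N v) w = -inner ℝ v (N w)) ∧
      inner ℝ ζ (B ζ) = 0 ∧ ∀ w, B w = N w - inner ℝ (B ζ) w • ζ + inner ℝ ζ w • B ζ := by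
  have hz : inner ℝ ζ (B ζ) = 0 := by
    have := hB.skew ζ ζ
    rw [real_inner_comm] at this
    have h2 := real_inner_comm ζ (B ζ)
    linarith
  -- Conjugation by `φ` kills the `ζ^⊥_c` part, and fixes a horizontal `N` anticommuting with `φ`,
  -- since then `φ N φ = -φ² N = N`.
  refine ⟨φ ∘ₗ B ∘ₗ φ, fun w ↦ rfl, fun w ↦ ?_, ?_, fun w ↦ h.inner_zeta_phi _, fun v w ↦ ?_,
    hz, fun w ↦ ?_⟩
  · have e : φ (φ (φ w)) = -φ w := by rw [h.phi_phi (φ w), h.inner_zeta_phi]; simp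
    have := hB.perp (φ w)
    rw [e, map_neg, map_neg, map_neg] at this
    simpa using this.symm
  · simp [h.phi_zeta]
  · simp only [LinearMap.comp_apply]
    rw [h.inner_phi_left, ← hB.skew, h.inner_phi_left]
  · have := hB.perp w
    simp only [LinearMap.comp_apply]
    rw [← this, h.phi_phi w, h.phi_phi, map_add, map_neg, map_smul, inner_add_right,
      inner_neg_right, inner_smul_right, hz, hB.skew ζ w]
    module

theorem IsAlmostContactMetric.phi_phi_phi (h : IsAlmostContactMetric φ ζ) (v : V) :
    φ (φ (φ v)) = -φ v := by
  rw [h.phi_phi, h.inner_zeta_phi]; simp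

theorem IsAlmostContactMetric.inner_phi_self (h : IsAlmostContactMetric φ ζ) (v : V) :
    inner ℝ v (φ v) = 0 := by
  have h1 := h.inner_phi_left v v
  rw [real_inner_comm] at h1
  linarith

/-- The two-form of `-[B, [B, φ]]` in terms of `B`. -/
theorem inner_negDoubleCommutator (h : IsAlmostContactMetric φ ζ) {B : V →ₗ[ℝ] V}
    (hB : IsUnitaryPerpEnd φ B) (v w : V) :
    inner ℝ v (negDoubleCommutator φ B w) = -4 * inner ℝ (B v) (φ (B w))
      + (inner ℝ ζ (B v) * inner ℝ ζ (B (φ w)) - inner ℝ ζ (B w) * inner ℝ ζ (B (φ v)))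
      + (inner ℝ ζ v * inner ℝ ζ (B (B (φ w))) - inner ℝ ζ w * inner ℝ ζ (B (B (φ v)))) := by
  obtain ⟨N, -, hNφ, hNz, hzN, hN, hz, hdec⟩ := hB.decomposition h
  -- Only `N` and the horizontal vector `a` remain. The `c` facts give each scalar a single
  -- orientation, so that the expansion becomes a polynomial identity.
  generalize B ζ = a at hz hdec
  have c1 : ∀ p, inner ℝ p ζ = inner ℝ ζ p := fun p ↦ real_inner_comm _ _
  have c2 := real_inner_comm a v
  have c3 : inner ℝ (N v) a = inner ℝ a (N v) := real_inner_comm _ _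
  have c4 : inner ℝ v (φ a) = -inner ℝ a (φ v) := by rw [← h.inner_phi_left, real_inner_comm]
  have c5 : inner ℝ (N v) (φ a) = -inner ℝ a (φ (N v)) := by
    rw [← h.inner_phi_left, real_inner_comm]
  have c7 : inner ℝ v (φ (N a)) = -inner ℝ a (φ (N v)) := by
    rw [← c5, hN, hNφ, inner_neg_right, neg_neg]
  have ca := h.inner_phi_self a
  have caz : inner ℝ a ζ = 0 := by rw [c1, hz]
  simp only [negDoubleCommutator_apply, hdec, map_add, map_sub, map_neg, map_smul, map_zero, hNφ,
    hNz, h.phi_zeta, inner_add_left, inner_add_right, inner_sub_left, inner_sub_right,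
    inner_neg_right, inner_smul_left, inner_smul_right, h.inner_zeta_phi, hzN, hN, hz, caz, c1,
    c2, c4, c7, ca, smul_zero, inner_zero_right, RCLike.conj_to_real, h.inner_zeta_zeta]
  ring

/-- On horizontal vectors the terms quadratic in `N` and those quadratic in `a = B ζ` both commute
with `φ`, and the cross terms are purely mixed, so only the `ζ`-component makes a difference. The
factor is `3 = 4 - 1`: at `v = ζ` the left side is zero, while `inner_negDoubleCommutator`
contributes `-4` and `+1` times the same scalar, as `⟪B ζ, φ B w⟫ = ⟪ζ, B B φ w⟫`. -/
theorem inner_phi_negDoubleCommutator_phi (h : IsAlmostContactMetric φ ζ) {B : V →ₗ[ℝ] V}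
    (hB : IsUnitaryPerpEnd φ B) (v w : V) :
    inner ℝ (φ v) (negDoubleCommutator φ B (φ w)) = inner ℝ v (negDoubleCommutator φ B w)
      + 3 * (inner ℝ ζ v * inner ℝ ζ (B (B (φ w))) - inner ℝ ζ w * inner ℝ ζ (B (B (φ v)))) := by
  obtain ⟨N, -, hNφ, hNz, hzN, hN, hz, hdec⟩ := hB.decomposition h
  generalize B ζ = a at hz hdec
  have c1 : ∀ p, inner ℝ p ζ = inner ℝ ζ p := fun p ↦ real_inner_comm _ _
  have c2 := real_inner_comm a v
  have c3 : inner ℝ (N v) a = inner ℝ a (N v) := real_inner_comm _ _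
  have c4 : inner ℝ v (φ a) = -inner ℝ a (φ v) := by rw [← h.inner_phi_left, real_inner_comm]
  have c5 : inner ℝ (N v) (φ a) = -inner ℝ a (φ (N v)) := by
    rw [← h.inner_phi_left, real_inner_comm]
  have c7 : inner ℝ v (φ (N a)) = -inner ℝ a (φ (N v)) := by
    rw [← c5, hN, hNφ, inner_neg_right, neg_neg]
  have ca := h.inner_phi_self a
  have caz : inner ℝ a ζ = 0 := by rw [c1, hz]
  simp only [negDoubleCommutator_apply, hdec, map_add, map_sub, map_neg, map_smul, map_zero, hNφ,
    hNz, h.phi_zeta, inner_add_right, inner_sub_right,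
    inner_neg_right, inner_smul_right, h.inner_zeta_phi, hzN, hz, caz, c1,
    c2, c4, c7, ca, smul_zero, inner_zero_right, h.inner_zeta_zeta, h.phi_phi, h.inner_phi_left]
  ring

/-- The algebraic properties of the part of `∇*∇φ` that is quadratic in the intrinsic torsion, where
`q` is the corresponding part of `∇*∇ζ`. -/
structure IsQuadraticPart (φ : V →ₗ[ℝ] V) (ζ : V) (Q : V →ₗ[ℝ] V) (q : V) : Prop where
  skew : ∀ v w, inner ℝ v (Q w) = -inner ℝ (Q v) w
  phi : ∀ v w, inner ℝ (φ v) (Q (φ w)) = inner ℝ v (Q w)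
    - 3 * (inner ℝ ζ v * inner ℝ q (φ w) - inner ℝ ζ w * inner ℝ q (φ v))

theorem isQuadraticPart_sum (h : IsAlmostContactMetric φ ζ) {ι : Type*} [Fintype ι]
    {B : ι → V →ₗ[ℝ] V} (hB : ∀ i, IsUnitaryPerpEnd φ (B i)) :
    IsQuadraticPart φ ζ (∑ i, negDoubleCommutator φ (B i)) (-∑ i, B i (B i ζ)) where
  skew v w := by
    simp only [LinearMap.sum_apply, inner_sum, sum_inner, ← Finset.sum_neg_distrib]
    refine Finset.sum_congr rfl fun i _ ↦ ?_
    have c := real_inner_comm w (negDoubleCommutator φ (B i) v)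
    have c' := h.inner_phi_left (B i v) (B i w)
    rw [real_inner_comm] at c'
    rw [inner_negDoubleCommutator h (hB i)] at c ⊢
    linarith
  phi v w := by
    have e : ∀ u, inner ℝ (-∑ i, B i (B i ζ)) u = -∑ i, inner ℝ ζ (B i (B i u)) := fun u ↦ by
      rw [inner_neg_left, sum_inner]
      refine congrArg _ (Finset.sum_congr rfl fun i _ ↦ ?_)
      rw [(hB i).skew, (hB i).skew, neg_neg]
    simp only [e, LinearMap.sum_apply, inner_sum,
      inner_phi_negDoubleCommutator_phi h (hB _), Finset.sum_add_distrib, ← Finset.mul_sum,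
      Finset.sum_sub_distrib]
    ring

/-- Since `C ζ = 0`, `C` is its part anticommuting with `φ`, hence `[C, φ] = -2 φ C` anticommutes
with `φ` too. By `hcomm` it also commutes on `ζ^⊥`, so it is zero, and `φ` is injective there. -/
theorem IsUnitaryPerpEnd.eq_zero (h : IsAlmostContactMetric φ ζ) {C : V →ₗ[ℝ] V}
    (hC : IsUnitaryPerpEnd φ C) (hz : C ζ = 0)
    (hcomm : ∀ v w, inner ℝ (φ (φ v)) (C (φ (φ (φ w))) - φ (C (φ (φ w)))) =
      inner ℝ (φ v) (C (φ (φ w)) - φ (C (φ w)))) (w : V) : C w = 0 := by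
  obtain ⟨N, -, hNφ, hNz, hzN, hN, -, hdec⟩ := hC.decomposition h
  have hCN : ∀ w, C w = N w := fun w ↦ by simp [hdec w, hz]
  have h0 : N w = 0 := by
    -- With this choice the two sides are `-2 ‖N w‖²` and `2 ‖N w‖²`.
    have h1 := hcomm (φ (N w)) w
    simp only [hCN, hNφ, h.phi_phi, inner_sub_right, inner_neg_right, map_add, map_neg, map_smul,
      h.phi_zeta, smul_zero, add_zero, zero_smul, hzN, hNz, inner_neg_left, neg_neg,
      h.inner_phi_left] at h1
    exact inner_self_eq_zero (𝕜 := ℝ).1 (by linarith)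
  rw [hCN, h0]

/-- The endomorphism `L = [C, φ] + Q` and the vector `l = C ζ + q`, for `C` in `u(n)^⊥` and quadratic
parts `Q` and `q`. -/
structure IsLaplacianDecomposition (φ : V →ₗ[ℝ] V) (ζ : V) (C Q L : V →ₗ[ℝ] V) (q l : V) :
    Prop where
  almostContact : IsAlmostContactMetric φ ζ
  perp : IsUnitaryPerpEnd φ C
  quadratic : IsQuadraticPart φ ζ Q q
  end_eq : ∀ w, L w = C (φ w) - φ (C w) + Q w
  vec_eq : l = C ζ + q

namespace IsLaplacianDecomposition

variable {C Q L : V →ₗ[ℝ] V} {q l : V}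

theorem skew (H : IsLaplacianDecomposition φ ζ C Q L q l) (v w : V) :
    inner ℝ v (L w) = -inner ℝ (L v) w := by
  simp only [H.end_eq, inner_add_left, inner_add_right, inner_sub_left, inner_sub_right,
    H.quadratic.skew v w, H.perp.skew v (φ w), H.almostContact.inner_phi_left]
  have h1 := H.almostContact.inner_phi_left v (C w)
  have h2 := H.perp.skew (φ v) w
  linarith

theorem inner_zeta_vec (H : IsLaplacianDecomposition φ ζ C Q L q l) :
    inner ℝ ζ (C ζ) = 0 := by
  have := H.perp.skew ζ ζ
  have h2 := real_inner_comm ζ (C ζ)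
  linarith

/-- `C` vanishes if and only if `l = q` and the horizontal part of `L` commutes with `φ`. -/
theorem eq_zero_iff (H : IsLaplacianDecomposition φ ζ C Q L q l) :
    (∀ w, C w = 0) ↔ (∀ v w, inner ℝ (φ (φ v)) (L (φ (φ w))) = inner ℝ (φ v) (L (φ w))) ∧
      l = q := by
  have hq : ∀ v w, inner ℝ (φ (φ v)) (Q (φ (φ w))) = inner ℝ (φ v) (Q (φ w)) := fun v w ↦ by
    rw [H.quadratic.phi, H.almostContact.inner_zeta_phi, H.almostContact.inner_zeta_phi]
    ring
  refine ⟨fun h ↦ ⟨fun v w ↦ ?_, by rw [H.vec_eq, h, zero_add]⟩, fun ⟨h, hl⟩ ↦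
    H.perp.eq_zero H.almostContact ?_ fun v w ↦ ?_⟩
  · simp only [H.end_eq, h, map_zero, sub_zero, zero_add, hq]
  · rw [H.vec_eq] at hl
    simpa using hl
  · have := h v w
    rw [H.end_eq, H.end_eq, inner_add_right, inner_add_right, hq] at this
    exact add_right_cancel this

theorem eq_zero_iff_horiz (H : IsLaplacianDecomposition φ ζ C Q L q l) :
    (∀ w, C w = 0) ↔ (∀ v w, inner ℝ (φ v) (L (φ w)) =
      inner ℝ (v - inner ℝ ζ v • ζ) (L (w - inner ℝ ζ w • ζ))) ∧ l = q := by
  have e : ∀ v, v - inner ℝ ζ v • ζ = -φ (φ v) := fun v ↦ by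
    rw [H.almostContact.phi_phi]; abel
  rw [H.eq_zero_iff]
  refine and_congr_left fun _ ↦ forall₂_congr fun v w ↦ ?_
  rw [e, e, map_neg, inner_neg_neg, eq_comm]

theorem eq_zero_iff_phi (H : IsLaplacianDecomposition φ ζ C Q L q l) :
    (∀ w, C w = 0) ↔ (∀ v w, inner ℝ (φ v) (L (φ w)) = inner ℝ v (L w)
      - 3 * (inner ℝ ζ v * inner ℝ l (φ w) - inner ℝ ζ w * inner ℝ l (φ v))) ∧ l = q := by
  refine ⟨fun h ↦ ?_, fun ⟨h, hl⟩ ↦ H.eq_zero_iff.2 ⟨fun v w ↦ ?_, hl⟩⟩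
  · have hl := (H.eq_zero_iff.1 h).2
    refine ⟨fun v w ↦ ?_, hl⟩
    simp only [H.end_eq, h, map_zero, sub_zero, zero_add, H.quadratic.phi v w, hl]
  -- Substituting `φ v` and `φ w` removes the `η` terms and leaves the horizontal criterion.
  · rw [h, H.almostContact.inner_zeta_phi, H.almostContact.inner_zeta_phi]
    ring

theorem eq_zero_iff_commutator (H : IsLaplacianDecomposition φ ζ C Q L q l) :
    (∀ w, C w = 0) ↔ (∀ w, L (φ w) - φ (L w) =
      (3 * inner ℝ ζ w) • l - (3 * inner ℝ l w) • ζ) ∧ l = q := by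
  have hA := H.almostContact
  refine ⟨fun h ↦ ?_, fun ⟨h, hl⟩ ↦ H.eq_zero_iff.2 ⟨fun v w ↦ ?_, hl⟩⟩
  · obtain ⟨hp, hl⟩ := H.eq_zero_iff_phi.1 h
    refine ⟨fun w ↦ ext_inner_left ℝ fun v ↦ ?_, hl⟩
    -- Replacing `w` by `φ w` produces `φ² w = -w + η(w) ζ`; the resulting term `⟪φ v, L ζ⟫` is
    -- evaluated by `h2`.
    have h1 := hp v (φ w)
    have h2 := hp (φ v) ζ
    have h3 := hA.inner_phi_left v (L w)
    simp only [hA.phi_phi, hA.phi_zeta, hA.inner_zeta_phi, hA.inner_zeta_zeta, map_add, map_neg,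
      map_smul, map_zero, inner_add_right, inner_neg_right, inner_smul_right, inner_zero_right]
      at h1 h2
    simp only [inner_sub_right, inner_smul_right]
    have c1 := real_inner_comm v l
    have c2 := real_inner_comm v ζ
    rw [← c1, ← c2]
    have h4 := congrArg (fun t ↦ inner ℝ ζ w * t) h2
    linarith
  · have h1 := h (φ w)
    have h2 := congrArg (fun u ↦ inner ℝ (φ (φ v)) u) h1
    have c : inner ℝ (φ (φ v)) ζ = 0 := by rw [real_inner_comm, hA.inner_zeta_phi]
    simp only [hA.inner_zeta_phi, inner_sub_right, inner_smul_right, c] at h2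
    have h3 := hA.inner_phi_left (φ (φ v)) (L (φ w))
    rw [hA.phi_phi_phi, inner_neg_left] at h3
    linarith

/-- No separate condition on `l` is needed: `[C, φ] = 0` at `ζ` gives `φ (C ζ) = 0`, and `C ζ` is
orthogonal to `ζ`, so `C ζ = 0`. -/
theorem eq_zero_iff_inner (H : IsLaplacianDecomposition φ ζ C Q L q l) :
    (∀ w, C w = 0) ↔ ∀ v w, inner ℝ v (L w) = inner ℝ v (Q w) := by
  have hA := H.almostContact
  refine ⟨fun h v w ↦ by simp [H.end_eq, h], fun h ↦ ?_⟩
  have hc : ∀ w, C (φ w) - φ (C w) = 0 := fun w ↦ ext_inner_left ℝ fun v ↦ by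
    have := h v w
    rw [H.end_eq, inner_add_right] at this
    rw [inner_zero_right]
    linarith
  refine H.perp.eq_zero hA ?_ fun v w ↦ by simp [hc]
  have h1 := hc ζ
  rw [hA.phi_zeta, map_zero, zero_sub, neg_eq_zero] at h1
  have h2 := hA.phi_phi (C ζ)
  rw [h1, map_zero, H.inner_zeta_vec, zero_smul, add_zero] at h2
  simpa using h2.symm

/-- The horizontal part of `L` lies in `u(n)` if `C` vanishes. -/
theorem horizontal_part (H : IsLaplacianDecomposition φ ζ C Q L q l) (v w : V) :
    inner ℝ v (L w) = inner ℝ v ((φ ∘ₗ φ ∘ₗ L ∘ₗ φ ∘ₗ φ) w)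
      + (inner ℝ (L ζ) v * inner ℝ ζ w - inner ℝ (L ζ) w * inner ℝ ζ v) := by
  have hA := H.almostContact
  have h1 := H.skew v ζ
  have h2 := H.skew ζ w
  have h3 := H.skew ζ ζ
  have h4 := real_inner_comm ζ (L ζ)
  have h5 := real_inner_comm v (L ζ)
  have h6 := real_inner_comm v ζ
  simp only [LinearMap.comp_apply, hA.phi_phi, map_add, map_neg, map_smul, inner_add_right,
    inner_neg_right, inner_smul_right]
  have h7 : inner ℝ ζ (L ζ) = 0 := by linarith
  rw [h6, h2, h7, h5]
  ring

end IsLaplacianDecomposition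
end

/-! ### The rough Laplacians of `φ`, `ζ`, `F` and `η` in terms of `ξ`. -/

section
variable {E : Type*} [NormedAddCommGroup E] [NormedSpace ℝ E] [FiniteDimensional ℝ E]
  {M : Type*} [TopologicalSpace M] [ChartedSpace E M] [IsManifold 𝓘(ℝ, E) ∞ M]
  [RiemannianBundle (fun x : M ↦ TangentSpace 𝓘(ℝ, E) x)]
  [IsContMDiffRiemannianBundle 𝓘(ℝ, E) ∞ E (fun x : M ↦ TangentSpace 𝓘(ℝ, E) x)]
  {x : M}

theorem nabla_sub {Y Y' : Π x : M, TangentSpace 𝓘(ℝ, E) x} (hY : MDiffAt (T% Y) x)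
    (hY' : MDiffAt (T% Y') x) (v : TangentSpace 𝓘(ℝ, E) x) :
    nabla (Y - Y') x v = nabla Y x v - nabla Y' x v := by
  rw [eq_sub_iff_add_eq, ← AlmostContactMetricStructure.nabla_add (mdifferentiableAt_sub_section hY hY') hY', sub_add_cancel]

theorem nabla_neg {Y : Π x : M, TangentSpace 𝓘(ℝ, E) x} (hY : MDiffAt (T% Y) x)
    (v : TangentSpace 𝓘(ℝ, E) x) : nabla (-Y) x v = -nabla Y x v := by
  have h0 : nabla (0 : Π x : M, TangentSpace 𝓘(ℝ, E) x) x v = 0 := by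
    simp [nabla]
  rw [eq_neg_iff_add_eq_zero, ← AlmostContactMetricStructure.nabla_add (mdifferentiableAt_neg_section hY) hY, neg_add_cancel,
    h0]

namespace AlmostContactMetricStructure

variable (S : AlmostContactMetricStructure E M)

theorem isAlmostContactMetric (x : M) :
    IsAlmostContactMetric (S.phi x : TangentSpace 𝓘(ℝ, E) x →ₗ[ℝ] TangentSpace 𝓘(ℝ, E) x)
      (S.zeta x) where
  inner_zeta_zeta := S.inner_zeta_zeta x
  phi_phi := S.phi_phi x
  phi_zeta := S.phi_zeta x
  inner_zeta_phi := S.inner_zeta_phi x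
  inner_phi_left := S.inner_phi_left x

/-- The endomorphism `ξ_v`. -/
noncomputable def torsionEnd (x : M) (v : TangentSpace 𝓘(ℝ, E) x) :
    TangentSpace 𝓘(ℝ, E) x →ₗ[ℝ] TangentSpace 𝓘(ℝ, E) x :=
  (S.isLinearMap_torsion x v).mk' (S.torsion x v)

theorem torsionEnd_apply (v w : TangentSpace 𝓘(ℝ, E) x) :
    S.torsionEnd x v w = S.torsion x v w := rfl

theorem isUnitaryPerpEnd_torsionEnd (v : TangentSpace 𝓘(ℝ, E) x) :
    IsUnitaryPerpEnd (S.phi x : TangentSpace 𝓘(ℝ, E) x →ₗ[ℝ] TangentSpace 𝓘(ℝ, E) x)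
      (S.torsionEnd x v) where
  skew p q := S.inner_torsion v p q
  perp w := (S.phi_torsion_phi v w).symm

/-- The endomorphism `∑ᵢ (∇_{eᵢ} ξ)_{eᵢ} = -d*ξ`. -/
noncomputable def divTorsionEnd (x : M) : TangentSpace 𝓘(ℝ, E) x →ₗ[ℝ] TangentSpace 𝓘(ℝ, E) x :=
  ∑ i, (S.isLinearMap_covEnd₂_nabla_torsion (orthoFrame x i) (orthoFrame x i)).mk' _

theorem divTorsionEnd_apply (w : TangentSpace 𝓘(ℝ, E) x) :
    S.divTorsionEnd x w =
      ∑ i, covEnd₂ nabla S.torsion x (orthoFrame x i) (orthoFrame x i) w := by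
  simp [divTorsionEnd]

theorem isHarmonic_iff : S.IsHarmonic ↔ ∀ x w, S.divTorsionEnd x w = 0 := by
  simp only [IsHarmonic, codiffTorsion, divTorsionEnd_apply, neg_eq_zero]

theorem divTorsionEnd_eq (w : TangentSpace 𝓘(ℝ, E) x) :
    S.divTorsionEnd x w = S.divTorsion x w + S.torsionTrace x w := by
  simp only [divTorsionEnd_apply, divTorsion, torsionTrace, covEnd₂_minConn_torsion_eq,
    ← Finset.sum_add_distrib]
  exact Finset.sum_congr rfl fun i _ ↦ by abel

/-- Skewness is seen with `∇`. The condition involving `φ` is seen only after passing to `∇^{U(n)}`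
by `divTorsionEnd_eq`, where both summands satisfy it. -/
theorem isUnitaryPerpEnd_divTorsionEnd (x : M) :
    IsUnitaryPerpEnd (S.phi x : TangentSpace 𝓘(ℝ, E) x →ₗ[ℝ] TangentSpace 𝓘(ℝ, E) x)
      (S.divTorsionEnd x) where
  skew p q := by
    simp only [divTorsionEnd_apply, inner_sum, sum_inner, ← Finset.sum_neg_distrib]
    exact Finset.sum_congr rfl fun i _ ↦ S.inner_covEnd₂_nabla_torsion _ _ _ _
  perp w := by
    simp only [divTorsionEnd_eq, divTorsion, torsionTrace, map_add, map_sum,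
      ContinuousLinearMap.coe_coe, S.phi_phi_covEnd₂_minConn_torsion_phi_phi, ← S.phi_torsion_phi]

/-- The product rule applied to `∇φ = [φ, ξ]`, with each new `∇φ` replaced by `[φ, ξ]` again. At `u
= v` the quadratic terms form the double commutator. -/
theorem covEnd₂_nabla_covEnd_phi (v u w : TangentSpace 𝓘(ℝ, E) x) :
    covEnd₂ nabla (covEnd nabla S.phiMap) x v u w =
      S.phi x (covEnd₂ nabla S.torsion x v u w) - covEnd₂ nabla S.torsion x v u (S.phi x w)
        + S.phi x (S.torsion x v (S.torsion x u w)) - S.torsion x v (S.phi x (S.torsion x u w))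
        - S.torsion x u (S.phi x (S.torsion x v w)) + S.torsion x u (S.torsion x v (S.phi x w)) := by
  have hu := mdifferentiableAt_extend 𝓘(ℝ, E) E u
  have hw := mdifferentiableAt_extend 𝓘(ℝ, E) E w
  have hpw := S.mdifferentiableAt_phi hw
  have ht := S.mdifferentiableAt_torsion hu hw
  have e : covEnd nabla S.phiMap = fun y v w ↦
      S.phi y (S.torsion y v w) - S.torsion y v (S.phi y w) := by
    funext y v w; exact S.covEnd_phi_eq v w
  have e2 : (fun y ↦ S.phi y (S.torsion y (extend E u y) (extend E w y))
        - S.torsion y (extend E u y) (S.phi y (extend E w y))) =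
      (fun y ↦ S.phi y (S.torsion y (extend E u y) (extend E w y)))
        - fun y ↦ S.torsion y (extend E u y) (S.phi y (extend E w y)) := rfl
  have h1 := S.covEnd_phi ht v
  have h2 := S.covEnd_phi hw v
  have h3 := S.covEnd₂_nabla_torsion hu hpw v
  have h4 := S.covEnd₂_nabla_torsion hu hw v
  rw [S.covEnd_phi_eq] at h1 h2
  simp only [extend_apply_self] at h1 h2 h3 h4
  have ha := (S.isLinearMap_torsion x u).map_add
  have hs := (S.isLinearMap_torsion x u).map_sub
  rw [eq_add_of_sub_eq h2.symm, ha, hs] at h3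
  rw [h3, h4]
  simp only [covEnd₂, e]
  rw [e2, nabla_sub (S.mdifferentiableAt_phi ht) (S.mdifferentiableAt_torsion hu hpw),
    eq_add_of_sub_eq h1.symm, map_sub, map_sub]
  abel

theorem covEnd_nabla_zeta (v u : TangentSpace 𝓘(ℝ, E) x) :
    covEnd nabla (nabla S.zeta) x v u =
      -covEnd₂ nabla S.torsion x v u (S.zeta x) + S.torsion x u (S.torsion x v (S.zeta x)) := by
  have hu := mdifferentiableAt_extend 𝓘(ℝ, E) E u
  have hz := S.mdifferentiableAt_zeta x
  have e : nabla S.zeta = fun y v ↦ -S.torsion y v (S.zeta y) := by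
    funext y v; exact S.nabla_zeta_eq v
  have h3 := S.covEnd₂_nabla_torsion hu hz v
  rw [S.nabla_zeta_eq, (S.isLinearMap_torsion x _).map_neg] at h3
  simp only [extend_apply_self] at h3
  have e2 : (fun y ↦ -S.torsion y (extend E u y) (S.zeta y)) =
      -fun y ↦ S.torsion y (extend E u y) (S.zeta y) := rfl
  rw [h3]
  simp only [covEnd]
  simp only [e]
  rw [e2, nabla_neg (S.mdifferentiableAt_torsion hu hz)]
  abel

/-- The quadratic part of `∇*∇φ`. -/
noncomputable def quadPhiEnd (x : M) : TangentSpace 𝓘(ℝ, E) x →ₗ[ℝ] TangentSpace 𝓘(ℝ, E) x :=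
  ∑ i, negDoubleCommutator (S.phi x : _ →ₗ[ℝ] _) (S.torsionEnd x (orthoFrame x i))

/-- `∇*∇φ` as an endomorphism, in terms of the intrinsic torsion. -/
noncomputable def lapPhiEnd (x : M) : TangentSpace 𝓘(ℝ, E) x →ₗ[ℝ] TangentSpace 𝓘(ℝ, E) x :=
  S.divTorsionEnd x ∘ₗ S.phi x - (S.phi x : _ →ₗ[ℝ] _) ∘ₗ S.divTorsionEnd x
    + S.quadPhiEnd x

theorem roughLapEnd_phi (w : TangentSpace 𝓘(ℝ, E) x) :
    roughLapEnd S.phiMap x w = S.lapPhiEnd x w := by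
  simp only [roughLapEnd, covEnd₂_nabla_covEnd_phi, lapPhiEnd, quadPhiEnd, LinearMap.add_apply,
    LinearMap.sub_apply, LinearMap.comp_apply, ContinuousLinearMap.coe_coe, divTorsionEnd_apply,
    LinearMap.sum_apply, negDoubleCommutator_apply, torsionEnd_apply, map_sum,
    ← Finset.sum_sub_distrib, ← Finset.sum_add_distrib, ← Finset.sum_neg_distrib]
  exact Finset.sum_congr rfl fun i _ ↦ by module

theorem roughLapVec_zeta (x : M) :
    roughLapVec S.zeta x = S.divTorsionEnd x (S.zeta x) + -S.torsionSqZeta x := by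
  simp only [roughLapVec, covEnd_nabla_zeta, divTorsionEnd_apply, torsionSqZeta,
    Finset.sum_add_distrib, Finset.sum_neg_distrib]
  abel

/-- The metric is parallel, so lowering an index commutes with both covariant derivatives. -/
theorem roughLapForm₂_fundForm (v w : TangentSpace 𝓘(ℝ, E) x) :
    roughLapForm₂ S.fundForm x v w = inner ℝ v (S.lapPhiEnd x w) := by
  rw [← roughLapEnd_phi, roughLapForm₂, roughLapEnd, inner_neg_right, inner_sum]
  refine congrArg _ (Finset.sum_congr rfl fun i _ ↦ ?_)
  have e : covForm₂ nabla S.fundForm =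
      fun y u v w ↦ inner ℝ v (covEnd nabla S.phiMap y u w) := by
    funext y u v w
    have hv := mdifferentiableAt_extend 𝓘(ℝ, E) E v
    have hw := S.mdifferentiableAt_phi (mdifferentiableAt_extend 𝓘(ℝ, E) E w)
    simp only [covForm₂, fundForm]
    rw [leviCivita_metric hv hw]
    simp only [extend_apply_self, covEnd, phiMap, nabla, inner_sub_right]
    ring
  have hv := mdifferentiableAt_extend 𝓘(ℝ, E) E v
  have hA := S.mdifferentiableAt_covEnd_phi
    (mdifferentiableAt_extend 𝓘(ℝ, E) E (orthoFrame x i)) (mdifferentiableAt_extend 𝓘(ℝ, E) E w)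
  simp only [covForm₃, e]
  rw [leviCivita_metric hv hA]
  simp only [extend_apply_self, covEnd₂, nabla, inner_sub_right]
  ring

theorem roughLapForm_eta (w : TangentSpace 𝓘(ℝ, E) x) :
    roughLapForm S.eta x w = inner ℝ (roughLapVec S.zeta x) w := by
  rw [roughLapForm, roughLapVec, inner_neg_left, sum_inner]
  refine congrArg _ (Finset.sum_congr rfl fun i _ ↦ ?_)
  have e : covForm nabla S.eta = fun y v w ↦ inner ℝ (nabla S.zeta y v) w := by
    funext y v w; exact S.covForm_eta v w
  have hw := mdifferentiableAt_extend 𝓘(ℝ, E) E w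
  have hN := mdifferentiableAt_nabla (S.contMDiff_zeta x)
    (mdifferentiableAt_extend 𝓘(ℝ, E) E (orthoFrame x i))
  simp only [covForm₂, e]
  rw [leviCivita_metric hN hw]
  simp only [extend_apply_self, covEnd, nabla, inner_sub_left]
  ring

theorem torsionSqEta_eq (w : TangentSpace 𝓘(ℝ, E) x) :
    S.torsionSqEta x w = inner ℝ (S.torsionSqZeta x) w := by
  simp only [torsionSqEta, torsionSqZeta, sum_inner, actForm, eta, neg_neg]
  refine Finset.sum_congr rfl fun i _ ↦ ?_
  rw [S.inner_torsion, S.inner_torsion, neg_neg]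

theorem isLaplacianDecomposition (x : M) :
    IsLaplacianDecomposition (S.phi x : TangentSpace 𝓘(ℝ, E) x →ₗ[ℝ] TangentSpace 𝓘(ℝ, E) x)
      (S.zeta x) (S.divTorsionEnd x) (S.quadPhiEnd x) (S.lapPhiEnd x) (-S.torsionSqZeta x)
      (roughLapVec S.zeta x) where
  almostContact := S.isAlmostContactMetric x
  perp := S.isUnitaryPerpEnd_divTorsionEnd x
  quadratic := isQuadraticPart_sum (S.isAlmostContactMetric x)
    fun i ↦ S.isUnitaryPerpEnd_torsionEnd (orthoFrame x i)
  end_eq _ := rfl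
  vec_eq := S.roughLapVec_zeta x

theorem inner_quadPhiEnd (v w : TangentSpace 𝓘(ℝ, E) x) :
    inner ℝ v (S.quadPhiEnd x w) =
      -4 * ∑ i, S.fundForm x (S.torsion x (orthoFrame x i) v) (S.torsion x (orthoFrame x i) w)
          + ∑ i, wedge (actForm (S.torsion x (orthoFrame x i)) (S.eta x))
              (fun u ↦ actForm (S.torsion x (orthoFrame x i)) (S.eta x) (S.phi x u)) v w
          + wedge (S.eta x) (fun u ↦ S.torsionSqEta x (S.phi x u)) v w := by
  simp only [quadPhiEnd, LinearMap.sum_apply, inner_sum,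
    inner_negDoubleCommutator (S.isAlmostContactMetric x) (S.isUnitaryPerpEnd_torsionEnd _),
    wedge, torsionSqEta, actForm, eta, fundForm, Finset.mul_sum, ← Finset.sum_add_distrib,
    ← Finset.sum_sub_distrib, torsionEnd_apply, ContinuousLinearMap.coe_coe]
  exact Finset.sum_congr rfl fun i _ ↦ by ring

end AlmostContactMetricStructure
end

/-! ### The conditions at a single point, and the types `C₅ ⊕ ⋯ ⊕ C₁₀ ⊕ C₁₂`. -/

section
variable {E : Type*} [NormedAddCommGroup E] [NormedSpace ℝ E] [FiniteDimensional ℝ E]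
  {M : Type*} [TopologicalSpace M] [ChartedSpace E M] [IsManifold 𝓘(ℝ, E) ∞ M]
  [RiemannianBundle (fun x : M ↦ TangentSpace 𝓘(ℝ, E) x)]
  [IsContMDiffRiemannianBundle 𝓘(ℝ, E) ∞ E (fun x : M ↦ TangentSpace 𝓘(ℝ, E) x)]
  {x : M}

namespace AlmostContactMetricStructure

variable (S : AlmostContactMetricStructure E M)

/-- `(v, w) ↦ ⟪φ² v, L φ² w⟫`. -/
noncomputable def horizForm (L : TangentSpace 𝓘(ℝ, E) x →ₗ[ℝ] TangentSpace 𝓘(ℝ, E) x) :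
    LinearMap.BilinForm ℝ (TangentSpace 𝓘(ℝ, E) x) :=
  (innerₗ (TangentSpace 𝓘(ℝ, E) x)).compl₁₂ (S.phi x ∘L S.phi x).toLinearMap
    (L ∘ₗ (S.phi x ∘L S.phi x).toLinearMap)

theorem horizForm_apply (L : TangentSpace 𝓘(ℝ, E) x →ₗ[ℝ] TangentSpace 𝓘(ℝ, E) x)
    (v w : TangentSpace 𝓘(ℝ, E) x) :
    S.horizForm L v w = inner ℝ (S.phi x (S.phi x v)) (L (S.phi x (S.phi x w))) := rfl

theorem inner_phi_phi_left (v w : TangentSpace 𝓘(ℝ, E) x) :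
    inner ℝ (S.phi x (S.phi x v)) w = inner ℝ v (S.phi x (S.phi x w)) := by
  rw [S.inner_phi_left, S.inner_phi_left, neg_neg]

theorem phi_horiz (v : TangentSpace 𝓘(ℝ, E) x) : S.phi x (S.horiz x v) = S.phi x v := by
  simp [horiz, S.phi_zeta]

theorem isUnitaryForm_horizForm {L : TangentSpace 𝓘(ℝ, E) x →ₗ[ℝ] TangentSpace 𝓘(ℝ, E) x}
    (hL : ∀ v w, inner ℝ v (L w) = -inner ℝ (L v) w)
    (hc : ∀ v w, inner ℝ (S.phi x (S.phi x v)) (L (S.phi x (S.phi x w))) =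
      inner ℝ (S.phi x v) (L (S.phi x w))) : S.IsUnitaryForm x (S.horizForm L) where
  skew v w := by rw [horizForm_apply, horizForm_apply, hL, real_inner_comm]
  zeta_left w := by simp [horizForm_apply, S.phi_zeta]
  phi_phi v w := by simp only [horizForm_apply, S.phi_horiz, hc]

theorem horiz_phi (v : TangentSpace 𝓘(ℝ, E) x) : S.horiz x (S.phi x v) = S.phi x v := by
  simp [horiz, eta, S.inner_zeta_phi]

/-- A two-form in `u(n) + η^⊥ ∧ η` has a horizontal part that commutes with `φ`. -/
theorem IsUnitaryForm.comm {S : AlmostContactMetricStructure E M}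
    {b : LinearMap.BilinForm ℝ (TangentSpace 𝓘(ℝ, E) x)} (hb : S.IsUnitaryForm x b)
    (v w : TangentSpace 𝓘(ℝ, E) x) :
    b (S.phi x (S.phi x v)) (S.phi x (S.phi x w)) = b (S.phi x v) (S.phi x w) := by
  rw [hb.phi_phi, horiz_phi, horiz_phi]

theorem divTorsionEnd_eq_zero_iff_end (x : M) :
    (∀ w, S.divTorsionEnd x w = 0) ↔ (∃ A, S.IsUnitaryEnd x A ∧ ∃ a, S.eta x a = 0 ∧
      ∀ w, roughLapEnd S.phiMap x w = A w + S.zetaPerp x a w) ∧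
      roughLapVec S.zeta x = -S.torsionSqZeta x := by
  have H := S.isLaplacianDecomposition x
  refine ⟨fun h ↦ ?_, fun ⟨⟨A, ⟨b, hb, hbA⟩, a, _, hLA⟩, hl⟩ ↦ H.eq_zero_iff.2 ⟨fun v w ↦ ?_, hl⟩⟩
  · obtain ⟨hc, hl⟩ := H.eq_zero_iff.1 h
    let φ := (S.phi x).toLinearMap
    -- `φ² L φ²` is the horizontal part of `L = ∇*∇φ`. Since `zetaPerp x a` sends `ζ` to `-a`, the
    -- vector is `a = -L ζ`.
    refine ⟨⟨φ ∘ₗ φ ∘ₗ S.lapPhiEnd x ∘ₗ φ ∘ₗ φ,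
      ⟨_, S.isUnitaryForm_horizForm H.skew hc, fun v w ↦ S.inner_phi_phi_left v _⟩,
      -S.lapPhiEnd x (S.zeta x), ?_, fun w ↦ ext_inner_left ℝ fun v ↦ ?_⟩, hl⟩
    · have h1 := H.skew (S.zeta x) (S.zeta x)
      have h2 := real_inner_comm (S.zeta x) (S.lapPhiEnd x (S.zeta x))
      rw [eta, inner_neg_right]
      linarith
    · have h1 := H.horizontal_part v w
      rw [roughLapEnd_phi, h1, inner_add_right, zetaPerp, inner_sub_right, inner_smul_right,
        inner_smul_right, inner_neg_right, inner_neg_left, real_inner_comm v (S.zeta x), eta,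
        real_inner_comm v (S.lapPhiEnd x (S.zeta x))]
      ring
  -- The `ζ^⊥_c` part pairs to zero on the image of `φ`, so there `L` has the form of `A`.
  · have e : ∀ v w, inner ℝ (S.phi x v) (S.lapPhiEnd x (S.phi x w)) =
        b (S.phi x v) (S.phi x w) := fun v w ↦ by
      rw [← roughLapEnd_phi, hLA, inner_add_right, ← hbA, zetaPerp, inner_sub_right,
        inner_smul_right, inner_smul_right, real_inner_comm (S.zeta x), S.inner_zeta_phi, eta,
        S.inner_zeta_phi]
      simp
    simp only [ContinuousLinearMap.coe_coe, e, hb.comm]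

theorem roughLapForm_eta_eq_iff (x : M) :
    (∀ w, roughLapForm S.eta x w = -S.torsionSqEta x w) ↔
      roughLapVec S.zeta x = -S.torsionSqZeta x := by
  simp only [roughLapForm_eta, torsionSqEta_eq, ← inner_neg_left]
  exact ⟨fun h ↦ ext_inner_right ℝ h, fun h w ↦ by rw [h]⟩

theorem divTorsionEnd_eq_zero_iff_form (x : M) :
    (∀ w, S.divTorsionEnd x w = 0) ↔ (∃ b, S.IsUnitaryForm x b ∧ ∃ a, S.eta x a = 0 ∧
      ∀ v w, roughLapForm₂ S.fundForm x v w =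
        b v w + wedge (fun u ↦ inner ℝ a u) (S.eta x) v w) ∧
      ∀ w, roughLapForm S.eta x w = -S.torsionSqEta x w := by
  have H := S.isLaplacianDecomposition x
  rw [roughLapForm_eta_eq_iff]
  refine ⟨fun h ↦ ?_, fun ⟨⟨b, hb, a, _, hL⟩, hl⟩ ↦ H.eq_zero_iff.2 ⟨fun v w ↦ ?_, hl⟩⟩
  · obtain ⟨hc, hl⟩ := H.eq_zero_iff.1 h
    -- Here `a = L ζ` without a sign, because `(a ∧ η)(v, ζ) = ⟪a, v⟫` for horizontal `a`.
    refine ⟨⟨_, S.isUnitaryForm_horizForm H.skew hc, S.lapPhiEnd x (S.zeta x), ?_, fun v w ↦ ?_⟩,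
      hl⟩
    · have h1 := H.skew (S.zeta x) (S.zeta x)
      have h2 := real_inner_comm (S.zeta x) (S.lapPhiEnd x (S.zeta x))
      rw [eta]
      linarith
    · rw [roughLapForm₂_fundForm, H.horizontal_part, horizForm_apply, inner_phi_phi_left]
      rfl
  · have e : ∀ v w, inner ℝ (S.phi x v) (S.lapPhiEnd x (S.phi x w)) =
        b (S.phi x v) (S.phi x w) := fun v w ↦ by
      rw [← roughLapForm₂_fundForm, hL, wedge, eta, eta, S.inner_zeta_phi, S.inner_zeta_phi]
      simp
    simp only [ContinuousLinearMap.coe_coe, e, hb.comm]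

/-- The second condition says that `C` has no `ζ`-component in its values; by skewness `C ζ = 0`,
and then only the horizontal block of `C` is left. -/
theorem divTorsionEnd_eq_zero_iff_minConn (x : M) :
    (∀ w, S.divTorsionEnd x w = 0) ↔
      (∀ v w, inner ℝ (S.divTorsion x (S.horiz x v)) (S.horiz x w)
          + inner ℝ (S.torsionTrace x (S.horiz x v)) (S.horiz x w) = 0) ∧
        (∀ w, actForm (S.divTorsion x) (S.eta x) w
          + actForm (S.torsionTrace x) (S.eta x) w = 0) := by
  have hskew := (S.isUnitaryPerpEnd_divTorsionEnd x).skew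
  have e : ∀ w, actForm (S.divTorsion x) (S.eta x) w + actForm (S.torsionTrace x) (S.eta x) w =
      -inner ℝ (S.zeta x) (S.divTorsionEnd x w) := fun w ↦ by
    rw [divTorsionEnd_eq, inner_add_right, actForm, actForm, eta, eta]
    ring
  simp only [e, ← inner_add_left, ← divTorsionEnd_eq, neg_eq_zero]
  refine ⟨fun h ↦ by simp [h], fun ⟨h, hz⟩ w ↦ ?_⟩
  have hCz : S.divTorsionEnd x (S.zeta x) = 0 := ext_inner_right ℝ fun w ↦ by
    have := hskew (S.zeta x) w
    rw [hz] at this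
    rw [inner_zero_left]
    linarith
  have hh : ∀ v, S.divTorsionEnd x (S.horiz x v) = S.divTorsionEnd x v := fun v ↦ by
    simp [horiz, hCz]
  refine ext_inner_right ℝ fun v ↦ ?_
  have := h w v
  rw [hh, horiz, inner_sub_right, inner_smul_right, real_inner_comm (S.zeta x), hz, mul_zero, sub_zero] at this
  rw [this, inner_zero_left]

/-- Elements of `ζ^⊥_c` satisfy `φ A φ = 0`, an identity that survives differentiation by
`∇^{U(n)}`. Thus the `N` part of `C` is zero. -/
theorem phi_divTorsionEnd_phi_of_isType (hS : S.IsTypeC5ToC10C12)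
    (w : TangentSpace 𝓘(ℝ, E) x) : S.phi x (S.divTorsionEnd x (S.phi x w)) = 0 := by
  have h : ∀ (y : M) (v w : TangentSpace 𝓘(ℝ, E) y),
      S.phi y (S.torsion y v (S.phi y w)) = 0 := fun y v w ↦ by
    obtain ⟨a, -, ha⟩ := hS y v
    simp [ha, zetaPerp, eta, S.inner_zeta_phi, S.phi_zeta]
  have h0 : ∀ v : TangentSpace 𝓘(ℝ, E) x,
      S.minConn (fun y ↦ (0 : TangentSpace 𝓘(ℝ, E) y)) x v = 0 := fun v ↦ by
    have : (fun y ↦ (0 : TangentSpace 𝓘(ℝ, E) y)) = (0 : Π y : M, TangentSpace 𝓘(ℝ, E) y) := rfl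
    simp [minConn, this, nabla, (S.isLinearMap_torsion x v).map_zero]
  simp only [divTorsionEnd_eq, divTorsion, torsionTrace, map_add, map_sum,
    phi_covEnd₂_minConn_torsion_phi, h, h0]
  simp

/-- Writing `ξ_{eᵢ}` with vector `a` gives `∇_{eᵢ} ζ = a` and `ξ_{eᵢ} ξ_{eᵢ} ζ = -‖a‖² ζ`, so the
quadratic part of `∇*∇ζ` is `‖∇ζ‖² ζ`; and `C`, having no `N` part, is determined by `C ζ`. -/
theorem divTorsionEnd_eq_zero_iff_of_isType (hS : S.IsTypeC5ToC10C12) (x : M) :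
    (∀ w, S.divTorsionEnd x w = 0) ↔
      roughLapVec S.zeta x = normSqNabla S.zeta x • S.zeta x := by
  have e : -S.torsionSqZeta x = normSqNabla S.zeta x • S.zeta x := by
    simp only [torsionSqZeta, normSqNabla, Finset.sum_smul, ← Finset.sum_neg_distrib]
    refine Finset.sum_congr rfl fun i _ ↦ ?_
    obtain ⟨a, ha, h⟩ := hS x (orthoFrame x i)
    have ha' : inner ℝ a (S.zeta x) = 0 := by rw [real_inner_comm]; exact ha
    have hz : S.torsion x (orthoFrame x i) (S.zeta x) = -a := by
      rw [h, zetaPerp, ha', eta, S.inner_zeta_zeta]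
      module
    rw [hz, nabla_zeta_eq, hz, neg_neg, (S.isLinearMap_torsion x _).map_neg, h, zetaPerp, ha,
      real_inner_self_eq_norm_sq]
    module
  rw [← e, S.roughLapVec_zeta]
  refine ⟨fun h ↦ by rw [h, zero_add], fun h w ↦ ?_⟩
  obtain ⟨N, hN, -, -, -, -, -, hdec⟩ :=
    (S.isUnitaryPerpEnd_divTorsionEnd x).decomposition (S.isAlmostContactMetric x)
  rw [hdec, add_eq_right.1 h, hN]
  simp [S.phi_divTorsionEnd_phi_of_isType hS]

end AlmostContactMetricStructure
end

/-! ### The equivalences on all of `M`, from those at each point. -/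

theorem theorem4p1
    {E : Type*} [NormedAddCommGroup E] [NormedSpace ℝ E] [FiniteDimensional ℝ E]
    {M : Type*} [TopologicalSpace M] [T2Space M] [SecondCountableTopology M]
    [ChartedSpace E M] [IsManifold 𝓘(ℝ, E) ∞ M]
    [RiemannianBundle (fun x : M ↦ TangentSpace 𝓘(ℝ, E) x)]
    [IsContMDiffRiemannianBundle 𝓘(ℝ, E) ∞ E (fun x : M ↦ TangentSpace 𝓘(ℝ, E) x)]
    (n : ℕ) (hn : finrank ℝ E = 2 * n + 1)
    (S : AlmostContactMetricStructure E M) :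
    List.TFAE [
      -- `d*ξ = 0`
      S.IsHarmonic,
      -- `∇*∇φ ∈ u(n) + ζ^⊥_c` and `∇*∇ζ = -ξ_{e_i} ξ_{e_i} ζ`
      (∀ x, ∃ A, S.IsUnitaryEnd x A ∧ ∃ a, S.eta x a = 0 ∧
          ∀ w, roughLapEnd S.phiMap x w = A w + S.zetaPerp x a w) ∧
        (∀ x, roughLapVec S.zeta x = -S.torsionSqZeta x),
      -- `[∇*∇φ, φ] = 3 η ⊗ ∇*∇ζ - 3 ∇*∇η ⊗ ζ` and `∇*∇ζ = -ξ_{e_i} ξ_{e_i} ζ`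
      (∀ x w, roughLapEnd S.phiMap x (S.phi x w) - S.phi x (roughLapEnd S.phiMap x w) =
          (3 * S.eta x w) • roughLapVec S.zeta x - (3 * roughLapForm S.eta x w) • S.zeta x) ∧
        (∀ x, roughLapVec S.zeta x = -S.torsionSqZeta x),
      -- `∇*∇F ∈ u(n) + η^⊥ ∧ η` and `∇*∇η = -ξ_{e_i}(ξ_{e_i} η)`
      (∀ x, ∃ b, S.IsUnitaryForm x b ∧ ∃ a, S.eta x a = 0 ∧
          ∀ v w, roughLapForm₂ S.fundForm x v w =
            b v w + wedge (fun u ↦ inner ℝ a u) (S.eta x) v w) ∧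
        (∀ x w, roughLapForm S.eta x w = -S.torsionSqEta x w),
      -- the same, with the membership written as an identity
      (∀ x v w, roughLapForm₂ S.fundForm x (S.phi x v) (S.phi x w) =
          roughLapForm₂ S.fundForm x (S.horiz x v) (S.horiz x w)) ∧
        (∀ x w, roughLapForm S.eta x w = -S.torsionSqEta x w),
      -- `∇*∇F(φX, φY) = ∇*∇F(X, Y) - 3 η ∧ (∇*∇η ∘ φ)(X, Y)` and `∇*∇η = -ξ_{e_i}(ξ_{e_i} η)`
      (∀ x v w, roughLapForm₂ S.fundForm x (S.phi x v) (S.phi x w) =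
          roughLapForm₂ S.fundForm x v w
            - 3 * wedge (S.eta x) (fun u ↦ roughLapForm S.eta x (S.phi x u)) v w) ∧
        (∀ x w, roughLapForm S.eta x w = -S.torsionSqEta x w),
      -- the formula for `∇*∇F` in terms of `ξ`
      ∀ x v w, roughLapForm₂ S.fundForm x v w =
        -4 * ∑ i, S.fundForm x (S.torsion x (orthoFrame x i) v) (S.torsion x (orthoFrame x i) w)
          + ∑ i, wedge (actForm (S.torsion x (orthoFrame x i)) (S.eta x))
              (fun u ↦ actForm (S.torsion x (orthoFrame x i)) (S.eta x) (S.phi x u)) v w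
          + wedge (S.eta x) (fun u ↦ S.torsionSqEta x (S.phi x u)) v w,
      -- componentwise vanishing of `(∇^{U(n)}_{e_i} ξ)_{e_i} + ξ_{ξ_{e_i} e_i}`
      (∀ x v w, inner ℝ (S.divTorsion x (S.horiz x v)) (S.horiz x w)
          + inner ℝ (S.torsionTrace x (S.horiz x v)) (S.horiz x w) = 0) ∧
        (∀ x w, actForm (S.divTorsion x) (S.eta x) w
          + actForm (S.torsionTrace x) (S.eta x) w = 0)] ∧
    (S.IsTypeC5ToC10C12 → (S.IsHarmonic ↔ IsHarmonicUnitVectorField S.zeta)) := by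
  have hC : S.IsHarmonic ↔ ∀ x w, S.divTorsionEnd x w = 0 := S.isHarmonic_iff
  have H := S.isLaplacianDecomposition
  refine ⟨?_, fun hS ↦ ?_⟩
  · tfae_have 1 ↔ 2 := by
      rw [hC, ← forall_and]
      exact forall_congr' S.divTorsionEnd_eq_zero_iff_end
    tfae_have 1 ↔ 3 := by
      rw [hC, ← forall_and]
      refine forall_congr' fun x ↦ ?_
      simp only [AlmostContactMetricStructure.roughLapEnd_phi,
        AlmostContactMetricStructure.roughLapForm_eta]
      exact (H x).eq_zero_iff_commutator
    tfae_have 1 ↔ 4 := by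
      rw [hC, ← forall_and]
      exact forall_congr' S.divTorsionEnd_eq_zero_iff_form
    tfae_have 1 ↔ 5 := by
      rw [hC, ← forall_and]
      refine forall_congr' fun x ↦ ?_
      rw [S.roughLapForm_eta_eq_iff]
      simp only [AlmostContactMetricStructure.roughLapForm₂_fundForm]
      exact (H x).eq_zero_iff_horiz
    tfae_have 1 ↔ 6 := by
      rw [hC, ← forall_and]
      refine forall_congr' fun x ↦ ?_
      rw [S.roughLapForm_eta_eq_iff]
      simp only [AlmostContactMetricStructure.roughLapForm₂_fundForm,
        AlmostContactMetricStructure.roughLapForm_eta]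
      exact (H x).eq_zero_iff_phi
    tfae_have 1 ↔ 7 := by
      rw [hC]
      refine forall_congr' fun x ↦ ?_
      simp only [AlmostContactMetricStructure.roughLapForm₂_fundForm, ← S.inner_quadPhiEnd]
      exact (H x).eq_zero_iff_inner
    tfae_have 1 ↔ 8 := by
      rw [hC, ← forall_and]
      exact forall_congr' S.divTorsionEnd_eq_zero_iff_minConn
    tfae_finish
  · have hu : ∀ x, ‖S.zeta x‖ = 1 := fun x ↦ by
      rw [norm_eq_sqrt_real_inner, S.inner_zeta_zeta, Real.sqrt_one]
    rw [hC, IsHarmonicUnitVectorField, and_iff_right hu]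
    exact forall_congr' (S.divTorsionEnd_eq_zero_iff_of_isType hS)
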